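/- Let $L^2(\mathbb R)$ be the real Hilbert space of square-integrable real functions with $(f,g)=\int fg$, let $\mathfrak g$ be the space of Hilbert–Schmidt operators on it, and let $I$ be the identity. Write $\mathbf A\doteq A(x,y)$ if $\mathbf A\in\mathfrak g$ is the integral operator with kernel $A\in L^2(\mathbb R^2)$. Let $$G=GL(L^2(\mathbb R))\cap(I+\mathfrak g),\qquad \mathcal L=I+\mathfrak l,\qquad \mathcal K=\{k\in G: kk^*=k^*k=I\},$$ where $\mathfrak l$ is the set of operators $(\mathbf A\varphi)(x)=\int_{-\infty}^xA(x,y)\varphi(y)\,dy$ with $A\in L^2(\mathbb R^2)$. For a bounded operator $\mathbf T$ on $L^2(\mathbb R)$ and $y\in\mathbb R$, let $\mathbf T|_{(-\infty,y)}$ be its truncation to $L^2(-\infty,y)$ (extend by zero, apply $\mathbf T$, restrict); if $\mathbf T\doteq T(x,z)$, it is $\varphi\mapsto\int_{-\infty}^yT(\cdot,z)\varphi(z)\,dz$. For a Hilbert–Schmidt operator $\mathbf A$ put $\mathcal R_2(\mathbf A)=(I+\mathbf A)e^{-\mathbf A}-I$, which is of trace class, $${\det}_2(I+\mathbf A)=\sum_{k\ge0}\operatorname{tr}\wedge^k\mathcal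 R_2(\mathbf A),\qquad D_2(\mathbf A)=-\mathbf A(I+\mathbf A)^{-1}{\det}_2(I+\mathbf A)\ \text{ if } I+\mathbf A\text{ is invertible}.$$ **Theorem 3.1.** Suppose $I+\mathbf K\in G$. Then $I+\mathbf K$ has a unique factorization $$I+\mathbf K=b_-\circ b_+^{-1},\qquad b_-\in\mathcal L,\ b_+\in\mathcal K.$$ Moreover $b_-\in G$. Put $\mathbf S=\mathbf K+\mathbf K^*+\mathbf K\mathbf K^*\doteq S(x,y)$ and $(b_-^{-1})^*-I\doteq C_+(x,y)$ (both operators are Hilbert–Schmidt). For every $y\in\mathbb R$ the operator $(I+\mathbf S)|_{(-\infty,y)}$ is invertible and ${\det}_2((I+\mathbf S)|_{(-\infty,y)})\neq0$. For almost every $y$, the function $S(\cdot,y)$ is square-integrable on $(-\infty,y)$, and $$C_+(x,y)=-\Big(\big((I+\mathbf S)|_{(-\infty,y)}\big)^{-1}S(\cdot,y)\Big)(x)=-S(x,y)-\frac{\big(D_2(\mathbf S|_{(-\infty,y)})S(\cdot,y)\big)(x)}{{\det}_2\big((I+\mathbf S)|_{(-\infty,y)}\big)}$$ for almost every $x<y$,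 and $C_+(x,y)=0$ for almost every $x>y$. -/

import Mathlib

open MeasureTheory
open scoped InnerProductSpace

noncomputable section

namespace HSFactor

universe u

/-! ### Hilbert–Schmidt operators and the regularized determinant -/

section General

variable {H : Type u} [NormedAddCommGroup H] [InnerProductSpace ℝ H] [CompleteSpace H]

/-- A bounded operator `A` is Hilbert–Schmidt if `∑ ‖A eᵢ‖² < ∞` for an orthonormal basis `e`
(the choice of the basis does not matter). -/
def IsHilbertSchmidt (A : H →L[ℝ] H) : Prop :=
  ∃ (ι : Type u) (e : HilbertBasis ι ℝ H), Summable fun i => ‖A (e i)‖ ^ 2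

/-- The principal minor `det (⟪eᵢ, T eⱼ⟫)_{i, j ∈ I}` of `T`. It is the diagonal matrix
entry of `⋀ᵏ T`, `k = |I|`, at the unit vector `e_I = e_{i₁} ∧ ⋯ ∧ e_{iₖ}` of `⋀ᵏ H`. -/
def principalMinor {ι : Type u} (e : HilbertBasis ι ℝ H) (T : H →L[ℝ] H) (I : Finset ι) : ℝ :=
  letI := Classical.decEq ι
  (Matrix.of fun i j : I => ⟪e i, T (e j)⟫_ℝ).det

/-- `t` is the trace of `⋀ᵏ T` on `⋀ᵏ H`: in the orthonormal basis `(e_I)`, `|I| = k`, of `⋀ᵏ H`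
that comes from an orthonormal basis `e` of `H`, the diagonal entries of `⋀ᵏ T` sum up
(unconditionally) to `t`, and `t` is the same for all `e`. -/
def IsWedgeTrace (k : ℕ) (T : H →L[ℝ] H) (t : ℝ) : Prop :=
  ∀ (ι : Type u) (e : HilbertBasis ι ℝ H),
    HasSum (fun I : {I : Finset ι // I.card = k} => principalMinor e T I.1) t

open Classical in
/-- The trace `tr ⋀ᵏ T` (it exists for every `k` when `T` is of trace class). -/
def wedgeTrace (k : ℕ) (T : H →L[ℝ] H) : ℝ :=
  if h : ∃ t, IsWedgeTrace k T t then h.choose else 0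

/-- The Fredholm determinant `det (I + T) = ∑ₖ tr ⋀ᵏ T` of a trace class operator `T`. -/
def fredholmDet (T : H →L[ℝ] H) : ℝ := ∑' k : ℕ, wedgeTrace k T

/-- `R₂(A) = (I + A) e^{-A} - I`, which is of trace class if `A` is Hilbert–Schmidt. -/
def regularize (A : H →L[ℝ] H) : H →L[ℝ] H := (1 + A) * NormedSpace.exp (-A) - 1

/-- The regularized determinant `det₂ (I + A) = det (I + R₂(A))`, as a function of `A`. -/
def det₂ (A : H →L[ℝ] H) : ℝ := fredholmDet (regularize A)

/-- The first Fredholm minor `D₂(A) = -A (I + A)⁻¹ det₂ (I + A)`. -/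
def minor₂ (A : H →L[ℝ] H) : H →L[ℝ] H := -(det₂ A • (A * Ring.inverse (1 + A)))

end General

/-! ### Integral operators on real `L²` spaces -/

/-- The integral operator on `L²(μ)` given by `A` has kernel `k ∈ L²(μ × μ)`. -/
def HasKernel (μ : Measure ℝ) (A : Lp ℝ 2 μ →L[ℝ] Lp ℝ 2 μ) (k : ℝ → ℝ → ℝ) : Prop :=
  MemLp (Function.uncurry k) 2 (μ.prod μ) ∧
    ∀ φ : Lp ℝ 2 μ, ∀ᵐ x ∂μ, A φ x = ∫ y, k x y * φ y ∂μ

/-- The real Hilbert space `L²(ℝ)`. -/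
abbrev L2R : Type := Lp ℝ 2 (volume : Measure ℝ)

/-- The real Hilbert space `L²(-∞, y)`. -/
abbrev L2Iio (y : ℝ) : Type := Lp ℝ 2 ((volume : Measure ℝ).restrict (Set.Iio y))

/-- The Hilbert–Schmidt group `G = GL(L²(ℝ)) ∩ (I + 𝔤)`. -/
def hsGroup : Set (L2R →L[ℝ] L2R) := {T | IsUnit T ∧ IsHilbertSchmidt (T - 1)}

/-- The subalgebra `𝔩` of Volterra operators `(A φ)(x) = ∫_{-∞}^x a(x, y) φ(y) dy`, `a ∈ L²(ℝ²)`. -/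
def lowerAlgebra : Set (L2R →L[ℝ] L2R) :=
  {A | ∃ a : ℝ → ℝ → ℝ, MemLp (Function.uncurry a) 2 (volume.prod volume) ∧
    ∀ φ : L2R, ∀ᵐ x, A φ x = ∫ y in Set.Iio x, a x y * φ y}

/-- The lower triangular Volterra group `𝓛 = I + 𝔩`. -/
def lowerGroup : Set (L2R →L[ℝ] L2R) := {b | b - 1 ∈ lowerAlgebra}

/-- The orthogonal group `𝓚 = {k ∈ G | k k* = k* k = I}`. -/
def orthogonalHS : Set (L2R →L[ℝ] L2R) :=
  {k | k ∈ hsGroup ∧ k * k.adjoint = 1 ∧ k.adjoint * k = 1}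

/-- Restriction of functions `L²(ℝ) → L²(-∞, y)`. -/
def restrictL2 (y : ℝ) : L2R →L[ℝ] L2Iio y :=
  LpToLpRestrictCLM ℝ ℝ ℝ volume 2 (Set.Iio y)

/-- The truncation `T|_{(-∞, y)}` of an operator `T` on `L²(ℝ)`: extend a function on `(-∞, y)`
by zero, apply `T`, restrict to `(-∞, y)`. The adjoint of the restriction is extension by zero. -/
def trunc (T : L2R →L[ℝ] L2R) (y : ℝ) : L2Iio y →L[ℝ] L2Iio y :=
  restrictL2 y ∘L T ∘L (restrictL2 y).adjoint

/-- The adjoint of the restriction is extension by zero. -/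
theorem adjoint_restrictL2 (y : ℝ) (φ : L2Iio y) :
    ((restrictL2 y).adjoint φ : ℝ → ℝ) =ᵐ[volume] (Set.Iio y).indicator φ := by
  have hm : MemLp ((Set.Iio y).indicator φ) 2 volume :=
    (memLp_indicator_iff_restrict measurableSet_Iio).2 (Lp.memLp φ)
  have h : (restrictL2 y).adjoint φ = hm.toLp _ := by
    refine ext_inner_right ℝ fun ψ => ?_
    rw [ContinuousLinearMap.adjoint_inner_left, L2.inner_def, L2.inner_def,
      ← integral_indicator measurableSet_Iio]
    refine integral_congr_ae ?_
    have h1 := LpToLpRestrictCLM_coeFn (𝕜 := ℝ) (Set.Iio y) ψ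
    rw [Filter.EventuallyEq, ae_restrict_iff' measurableSet_Iio] at h1
    filter_upwards [h1, hm.coeFn_toLp] with x hx hx'
    rw [hx']
    by_cases hxy : x ∈ Set.Iio y
    · simp only [Set.indicator_of_mem hxy]
      rw [← hx hxy]
      rfl
    · simp [Set.indicator_of_notMem hxy]
  rw [h]
  exact hm.coeFn_toLp

/-- On an integral operator with kernel `k`, the truncation is
`φ ↦ (x ↦ ∫_{-∞}^y k(x, z) φ(z) dz)`. -/
theorem hasKernel_trunc {T : L2R →L[ℝ] L2R} {k : ℝ → ℝ → ℝ} (h : HasKernel volume T k) (y : ℝ) :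
    HasKernel (volume.restrict (Set.Iio y)) (trunc T y) k := by
  refine ⟨?_, fun φ => ?_⟩
  · rw [Measure.prod_restrict]
    exact h.1.restrict _
  · have h1 := LpToLpRestrictCLM_coeFn (𝕜 := ℝ) (Set.Iio y) (T ((restrictL2 y).adjoint φ))
    filter_upwards [h1, ae_restrict_of_ae (h.2 ((restrictL2 y).adjoint φ))] with x hx hx'
    refine (hx.trans hx').trans ?_
    rw [← integral_indicator measurableSet_Iio]
    refine integral_congr_ae ?_
    filter_upwards [adjoint_restrictL2 y φ] with z hz
    rw [hz]
    by_cases hzy : z ∈ Set.Iio y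
    · simp [Set.indicator_of_mem hzy]
    · simp [Set.indicator_of_notMem hzy]

/-- The truncation of the identity is the identity. -/
theorem trunc_one (y : ℝ) : trunc 1 y = 1 := by
  ext1 φ
  refine Lp.ext ?_
  have h1 := LpToLpRestrictCLM_coeFn (𝕜 := ℝ) (Set.Iio y) ((restrictL2 y).adjoint φ)
  have h2 := ae_restrict_of_ae (s := Set.Iio y) (adjoint_restrictL2 y φ)
  have h3 : ∀ᵐ x ∂(volume.restrict (Set.Iio y)), x ∈ Set.Iio y :=
    ae_restrict_mem measurableSet_Iio
  filter_upwards [h1, h2, h3] with x hx hx' hx3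
  refine (hx.trans hx').trans ?_
  rw [Set.indicator_of_mem hx3]
  rfl

end HSFactor

end

/-!
The heart of the matter is the triangular factorization `1 + S = b b*` of the positive operator
`1 + S = (1 + K)(1 + K)*`, with `b` a lower triangular Hilbert–Schmidt perturbation of the
identity; `b₊ = (1 + K)⁻¹ b` is then orthogonal. "Lower triangular" is treated as invariance of
the subspaces `tail q = L²(q, ∞)`. For Hilbert–Schmidt operators this is the same as having a
Volterra kernel (`HasKernel.ae_eq_zero`, `mem_lowerAlgebra_of_isTriangular`), and an operator which
is triangular together with its adjoint has a kernel supported on the diagonal, hence is zero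
(`eq_zero_of_isTriangular_adjoint`).

*Existence* (`exists_lower_mul_adjoint`). By Lax–Milgram on the Hilbert space of Hilbert–Schmidt
operators with triangular adjoint there is a `C` in this space such that `S + C + S C` is
triangular (`exists_triangular_solution`). With `b = (1 + S)(1 + C)` the operator `(1 + C)* b` is
triangular and self-adjoint, so it is `1`. By the Fredholm alternative `(1 + C)*` is then a
two-sided inverse of `b`, and `b b* = (1 + S)(1 + C) b* = 1 + S`.

*Uniqueness* (`lower_factor_unique`). If `b b* = b' b'*`, then `b⁻¹ b'` is orthogonal, so that it
and its adjoint are both triangular. That inverses of triangular operators are triangular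
(`IsTriangular.inverse`) again comes from the Fredholm alternative.

*The formula* (`HasKernel.ae_trunc_column_eq`). Reading `S + C + S C = b - 1` column by column, for
almost every `y` the column of `C = (b⁻¹)* - 1` at `y` is supported on `(-∞, y)`, where the column
of `b - 1` vanishes. This is the equation `(1 + S)|_{(-∞, y)} c(·, y) = -s(·, y)`, and the
truncation of the coercive operator `1 + S` is coercive, hence invertible.

*The determinant* (`det₂_ne_zero`). The truncation `A` of `S` is self-adjoint and Hilbert–Schmidt,
with eigenvalues `c > -1` in an orthonormal basis. Then `R₂(A)` has eigenvalues `-w ∈ (-1, 0]` with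
`∑ w < ∞`. By the Cauchy–Binet formula and Tonelli's theorem the principal minors of `R₂(A)` in an
arbitrary orthonormal basis sum up to the elementary symmetric functions of the `-w`, so that `det₂`
is the convergent product `∏ (1 - w)` of nonzero factors.
-/

set_option linter.unusedSectionVars false

noncomputable section

namespace HSFactor

universe u

/-! ### Hilbert–Schmidt operators on a Hilbert space -/

section General

variable {H : Type u} [NormedAddCommGroup H] [InnerProductSpace ℝ H] [CompleteSpace H]

theorem hasSum_sq_inner {ι : Type*} (e : HilbertBasis ι ℝ H) (x : H) :
    HasSum (fun i => ⟪e i, x⟫_ℝ ^ 2) (‖x‖ ^ 2) := by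
  have h := e.hasSum_inner_mul_inner x x
  rw [real_inner_self_eq_norm_sq] at h
  refine h.congr_fun fun i => ?_
  rw [real_inner_comm x (e i), sq]

/-- The adjoint of a Hilbert–Schmidt operator is square-summable along every orthonormal basis:
both double sums equal `∑ ⟪f j, A (e i)⟫²`. -/
theorem summable_adjoint {ι κ : Type*} (e : HilbertBasis ι ℝ H) (f : HilbertBasis κ ℝ H)
    {A : H →L[ℝ] H} (hA : Summable fun i => ‖A (e i)‖ ^ 2) :
    Summable fun j => ‖A.adjoint (f j)‖ ^ 2 := by
  have h1 : Summable fun p : ι × κ => ⟪f p.2, A (e p.1)⟫_ℝ ^ 2 := by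
    rw [summable_prod_of_nonneg fun p => sq_nonneg _]
    refine ⟨fun i => (hasSum_sq_inner f (A (e i))).summable, ?_⟩
    simpa only [(hasSum_sq_inner f (A (e _))).tsum_eq] using hA
  have h2 : Summable fun p : κ × ι => ⟪f p.1, A (e p.2)⟫_ℝ ^ 2 := h1.prod_symm
  rw [summable_prod_of_nonneg fun p => sq_nonneg _] at h2
  refine h2.2.congr fun j => ?_
  rw [← (hasSum_sq_inner e (A.adjoint (f j))).tsum_eq]
  refine tsum_congr fun i => ?_
  rw [ContinuousLinearMap.adjoint_inner_right, real_inner_comm]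

theorem IsHilbertSchmidt.summable {A : H →L[ℝ] H} (hA : IsHilbertSchmidt A) {κ : Type*}
    (f : HilbertBasis κ ℝ H) : Summable fun j => ‖A (f j)‖ ^ 2 := by
  obtain ⟨ι, e, he⟩ := hA
  have h := summable_adjoint e e he
  simpa using summable_adjoint e f h

theorem exists_hilbertBasis_type (H : Type u) [NormedAddCommGroup H] [InnerProductSpace ℝ H]
    [CompleteSpace H] : ∃ ι : Type u, Nonempty (HilbertBasis ι ℝ H) := by
  obtain ⟨w, b, -⟩ := exists_hilbertBasis ℝ H
  exact ⟨w, ⟨b⟩⟩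

theorem IsHilbertSchmidt.adjoint {A : H →L[ℝ] H} (hA : IsHilbertSchmidt A) :
    IsHilbertSchmidt A.adjoint := by
  obtain ⟨ι, e, he⟩ := hA
  exact ⟨ι, e, summable_adjoint e e he⟩

theorem IsHilbertSchmidt.mul_left {A : H →L[ℝ] H} (hA : IsHilbertSchmidt A) (T : H →L[ℝ] H) :
    IsHilbertSchmidt (T * A) := by
  obtain ⟨ι, e, he⟩ := hA
  refine ⟨ι, e, (he.mul_left (‖T‖ ^ 2)).of_nonneg_of_le (fun i => sq_nonneg _) fun i => ?_⟩
  rw [← mul_pow]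
  gcongr
  exact T.le_opNorm _

theorem IsHilbertSchmidt.mul_right {A : H →L[ℝ] H} (hA : IsHilbertSchmidt A) (T : H →L[ℝ] H) :
    IsHilbertSchmidt (A * T) := by
  have h := (hA.adjoint.mul_left T.adjoint).adjoint
  rwa [ContinuousLinearMap.mul_def, ContinuousLinearMap.adjoint_comp,
    ContinuousLinearMap.adjoint_adjoint, ContinuousLinearMap.adjoint_adjoint] at h

theorem IsHilbertSchmidt.neg {A : H →L[ℝ] H} (hA : IsHilbertSchmidt A) :
    IsHilbertSchmidt (-A) := by
  obtain ⟨ι, e, he⟩ := hA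
  exact ⟨ι, e, by simpa using he⟩

theorem IsHilbertSchmidt.add {A B : H →L[ℝ] H} (hA : IsHilbertSchmidt A)
    (hB : IsHilbertSchmidt B) : IsHilbertSchmidt (A + B) := by
  obtain ⟨ι, e, he⟩ := hA
  refine ⟨ι, e, ((he.add (hB.summable e)).mul_left 2).of_nonneg_of_le (fun i => sq_nonneg _)
    fun i => ?_⟩
  calc ‖(A + B) (e i)‖ ^ 2 ≤ (‖A (e i)‖ + ‖B (e i)‖) ^ 2 := by
        gcongr
        exact norm_add_le _ _
    _ ≤ 2 * (‖A (e i)‖ ^ 2 + ‖B (e i)‖ ^ 2) := add_sq_le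

theorem IsHilbertSchmidt.sub {A B : H →L[ℝ] H} (hA : IsHilbertSchmidt A)
    (hB : IsHilbertSchmidt B) : IsHilbertSchmidt (A - B) := by
  rw [sub_eq_add_neg]
  exact hA.add hB.neg

/-- Cauchy–Schwarz for `∑ ⟪e i, x⟫ • v i`, the sum that represents an operator by its values `v i`
on the basis vectors `e i`. -/
theorem summable_smul_and_norm_sum_le {ι : Type*} (e : HilbertBasis ι ℝ H) {v : ι → H}
    (hv : Summable fun i => ‖v i‖ ^ 2) (x : H) :
    (Summable fun i => ⟪e i, x⟫_ℝ • v i) ∧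
      ‖∑' i, ⟪e i, x⟫_ℝ • v i‖ ≤ √(∑' i, ‖v i‖ ^ 2) * ‖x‖ := by
  have hx := hasSum_sq_inner e x
  have h := Real.summable_and_inner_le_Lp_mul_Lq_tsum_of_nonneg
    (f := fun i => |⟪e i, x⟫_ℝ|) (g := fun i => ‖v i‖) Real.HolderConjugate.two_two
    (fun i => abs_nonneg _) (fun i => norm_nonneg _)
    (by simpa using hx.summable) (by simpa using hv)
  have hs : Summable fun i => ‖⟪e i, x⟫_ℝ • v i‖ := by
    simpa only [norm_smul, Real.norm_eq_abs] using h.1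
  refine ⟨hs.of_norm, (norm_tsum_le_tsum_norm hs).trans ?_⟩
  simp only [norm_smul, Real.norm_eq_abs]
  refine h.2.trans (le_of_eq ?_)
  simp only [Real.rpow_ofNat, sq_abs]
  rw [hx.tsum_eq, ← Real.sqrt_eq_rpow, ← Real.sqrt_eq_rpow, Real.sqrt_sq (norm_nonneg x), mul_comm]

/-- A Hilbert–Schmidt operator is compact: it is the norm limit of the finite rank operators
`∑ i ∈ F, ⟪e i, ·⟫ • A (e i)`. -/
theorem IsHilbertSchmidt.isCompactOperator {A : H →L[ℝ] H} (hA : IsHilbertSchmidt A) :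
    IsCompactOperator A := by
  classical
  obtain ⟨ι, e, he⟩ := hA
  let P : Finset ι → H →L[ℝ] H := fun F => ∑ i ∈ F, (innerSL ℝ (e i)).smulRight (A (e i))
  have hP : ∀ F x, P F x = ∑ i ∈ F, ⟪e i, x⟫_ℝ • A (e i) := fun F x => by
    simp [P]
  have hbd : ∀ F, ‖A - P F‖ ≤ √(∑' i : {i // i ∉ F}, ‖A (e i)‖ ^ 2) := fun F => by
    refine ContinuousLinearMap.opNorm_le_bound _ (Real.sqrt_nonneg _) fun x => ?_
    let v : ι → H := fun i => if i ∈ F then 0 else A (e i)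
    have hv : (fun i => ‖v i‖ ^ 2) = Set.indicator {i | i ∉ F} fun i => ‖A (e i)‖ ^ 2 := by
      ext i
      by_cases hi : i ∈ F <;> simp [v, hi]
    have hvs : Summable fun i => ‖v i‖ ^ 2 := by
      rw [hv]
      exact he.indicator _
    have h1 := summable_smul_and_norm_sum_le e hvs x
    have h2 : HasSum (fun i => ⟪e i, x⟫_ℝ • A (e i)) (A x) := by
      simpa [e.repr_apply_apply] using (e.hasSum_repr x).mapL A
    have h3 : (A - P F) x = ∑' i, ⟪e i, x⟫_ℝ • v i := by
      rw [sub_apply, hP, sub_eq_iff_eq_add, ← h2.tsum_eq]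
      have h4 : HasSum (fun i => if i ∈ F then ⟪e i, x⟫_ℝ • A (e i) else 0)
          (∑ i ∈ F, ⟪e i, x⟫_ℝ • A (e i)) := by
        have h5 : HasSum (fun i => if i ∈ F then ⟪e i, x⟫_ℝ • A (e i) else 0)
            (∑ i ∈ F, if i ∈ F then ⟪e i, x⟫_ℝ • A (e i) else 0) :=
          hasSum_sum_of_ne_finset_zero fun i hi => by simp [hi]
        rwa [Finset.sum_congr rfl fun i hi => if_pos hi] at h5
      rw [← h4.tsum_eq, ← h1.1.tsum_add h4.summable]
      refine tsum_congr fun i => ?_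
      by_cases hi : i ∈ F <;> simp [v, hi]
    rw [h3]
    refine h1.2.trans (le_of_eq ?_)
    rw [hv, ← tsum_subtype]
    rfl
  have hlim : Filter.Tendsto P Filter.atTop (nhds A) := by
    rw [tendsto_iff_norm_sub_tendsto_zero]
    have h0 : Filter.Tendsto (fun F : Finset ι => √(∑' i : {i // i ∉ F}, ‖A (e i)‖ ^ 2))
        Filter.atTop (nhds 0) := by
      have := (tendsto_tsum_compl_atTop_zero fun i => ‖A (e i)‖ ^ 2).sqrt
      simpa using this
    refine squeeze_zero (fun F => norm_nonneg _) (fun F => ?_) h0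
    rw [norm_sub_rev]
    exact hbd F
  refine isCompactOperator_of_tendsto hlim (Filter.Eventually.of_forall fun F => ?_)
  have hsum : ∀ G : Finset ι, IsCompactOperator (P G) := fun G => by
    induction G using Finset.induction_on with
    | empty => simpa [P] using isCompactOperator_zero
    | insert i G hi ih =>
      have : P (insert i G) = (innerSL ℝ (e i)).smulRight (A (e i)) + P G := by
        simp [P, Finset.sum_insert hi]
      rw [this]
      refine IsCompactOperator.add (f := ⇑((innerSL ℝ (e i)).smulRight (A (e i)))) ?_ ih
      exact (isCompactOperator_id (E := ℝ)).comp_clm (innerSL ℝ (e i)) |>.clm_comp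
        ((ContinuousLinearMap.id ℝ ℝ).smulRight (A (e i)))
  exact hsum F

/-- The Fredholm alternative for `1 + A`. -/
theorem isUnit_one_add_of_isCompactOperator {A : H →L[ℝ] H} (hA : IsCompactOperator A)
    (hinj : ∀ x, (1 + A) x = 0 → x = 0) : IsUnit (1 + A) := by
  rcases hA.hasEigenvalue_or_mem_resolventSet (μ := (-1 : ℝ)) (by norm_num) with h | h
  · obtain ⟨x, hx⟩ := h.exists_hasEigenvector
    have h1 : A x = -x := by simpa using hx.apply_eq_smul
    exact absurd (hinj x (by simp [h1])) hx.2
  · rw [spectrum.mem_resolventSet_iff] at h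
    have h2 : algebraMap ℝ (H →L[ℝ] H) (-1) - A = -(1 + A) := by
      rw [map_neg, map_one]
      abel
    rw [h2] at h
    simpa using h.neg

end General

/-! ### Coercive operators -/

section Coercive

variable {V : Type*} [NormedAddCommGroup V] [InnerProductSpace ℝ V] [CompleteSpace V]

theorem isUnit_of_coercive {T : V →L[ℝ] V} {δ : ℝ} (hδ : 0 < δ)
    (h : ∀ x, δ * ‖x‖ ^ 2 ≤ ⟪T x, x⟫_ℝ) : IsUnit T := by
  have hB : IsCoercive ((innerSL ℝ).comp T : V →L[ℝ] V →L[ℝ] ℝ) :=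
    ⟨δ, hδ, fun x => by simpa [sq, mul_assoc] using h x⟩
  have hT : (hB.continuousLinearEquivOfBilin : V →L[ℝ] V) = T := by
    ext x
    exact (hB.unique_continuousLinearEquivOfBilin fun w => rfl).symm
  rw [← hT]
  exact (ContinuousLinearEquiv.unitsEquiv ℝ V).symm hB.continuousLinearEquivOfBilin |>.isUnit

/-- The compression of a coercive operator to a closed subspace is onto (Lax–Milgram). -/
theorem exists_mem_forall_inner_eq_zero {P : V →L[ℝ] V} {δ : ℝ} (hδ : 0 < δ)
    (h : ∀ x, δ * ‖x‖ ^ 2 ≤ ⟪P x, x⟫_ℝ) (U : Submodule ℝ V) [CompleteSpace U] (s : V) :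
    ∃ u ∈ U, ∀ w ∈ U, ⟪P u + s, w⟫_ℝ = 0 := by
  let T : U →L[ℝ] U := U.orthogonalProjectionOnto ∘L P ∘L U.subtypeL
  have hT : ∀ x w : U, ⟪T x, w⟫_ℝ = ⟪P x, (w : V)⟫_ℝ := fun x w => by
    simp [T]
  obtain ⟨T', hT'⟩ := isUnit_of_coercive (T := T) hδ fun x => by
    rw [hT]
    exact h x
  let u : U := -((↑T'⁻¹ : U →L[ℝ] U) (U.orthogonalProjectionOnto s))
  have hu : T u = -U.orthogonalProjectionOnto s := by
    have h1 : (T' : U →L[ℝ] U) * ↑T'⁻¹ = 1 := T'.mul_inv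
    have h2 := congrArg (fun f : U →L[ℝ] U => f (U.orthogonalProjectionOnto s)) h1
    simp only [mul_apply_eq_comp, hT', one_apply_eq_self] at h2
    simp only [u, map_neg, h2]
  refine ⟨u, u.2, fun w hw => ?_⟩
  have h3 := hT u ⟨w, hw⟩
  rw [hu, inner_neg_left] at h3
  have h4 : ⟪U.orthogonalProjectionOnto s, (⟨w, hw⟩ : U)⟫_ℝ = ⟪s, w⟫_ℝ := by simp
  rw [inner_add_left, ← h3, h4, neg_add_cancel]

end Coercive

/-! ### Triangular operators with respect to a nest of subspaces -/

section Nest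

variable {H : Type u} [NormedAddCommGroup H] [InnerProductSpace ℝ H] [CompleteSpace H]
variable {α : Type*}

/-- `T` is triangular with respect to the family `N` of subspaces: it leaves each `N q`
invariant. -/
def IsTriangular (N : α → Submodule ℝ H) (T : H →L[ℝ] H) : Prop :=
  ∀ q, ∀ x ∈ N q, T x ∈ N q

variable {N : α → Submodule ℝ H}

theorem IsTriangular.one : IsTriangular N 1 := fun _ _ hx => hx

theorem IsTriangular.mul {T T' : H →L[ℝ] H} (h : IsTriangular N T) (h' : IsTriangular N T') :
    IsTriangular N (T * T') := fun q x hx => h q _ (h' q x hx)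

theorem IsTriangular.sub {T T' : H →L[ℝ] H} (h : IsTriangular N T) (h' : IsTriangular N T') :
    IsTriangular N (T - T') := fun q x hx => (N q).sub_mem (h q x hx) (h' q x hx)

theorem IsTriangular.add {T T' : H →L[ℝ] H} (h : IsTriangular N T) (h' : IsTriangular N T') :
    IsTriangular N (T + T') := fun q x hx => (N q).add_mem (h q x hx) (h' q x hx)

/-- The inverse of a triangular operator is triangular if the operator is a compact perturbation of
the identity: with `Q` the orthogonal projection onto `N q`, the operator `1 + Q A Q` is injective,
hence onto, and it agrees with `1 + A` on `N q`. -/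
theorem IsTriangular.inverse [∀ q, (N q).HasOrthogonalProjection] {A : H →L[ℝ] H}
    (hA : IsCompactOperator A) (hu : IsUnit (1 + A)) (h : IsTriangular N (1 + A)) :
    IsTriangular N (Ring.inverse (1 + A)) := by
  intro q x hx
  have hA' : ∀ z ∈ N q, A z ∈ N q := fun z hz => by
    have := (N q).sub_mem (h q z hz) hz
    simpa using this
  let Q : H →L[ℝ] H := (N q).starProjection
  have hQ : ∀ z ∈ N q, Q z = z := fun z hz => Submodule.starProjection_eq_self_iff.2 hz
  have hQm : ∀ z, Q z ∈ N q := fun z => Submodule.starProjection_apply_mem _ z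
  have hinv : Ring.inverse (1 + A) * (1 + A) = 1 := Ring.inverse_mul_cancel _ hu
  have hinj : ∀ z, z + A z = 0 → z = 0 := fun z hz => by
    have h1 := congrArg (fun T : H →L[ℝ] H => T z) hinv
    simpa [hz] using h1.symm
  have key : ∀ y ∈ N q, ∀ z, (1 + Q * A * Q) z = y → z ∈ N q ∧ z + A z = y := fun y hy z hz => by
    have hz' : z + Q (A (Q z)) = y := hz
    have hzm : z ∈ N q := by
      rw [← eq_sub_iff_add_eq] at hz'
      rw [hz']
      exact (N q).sub_mem hy (hQm _)
    rw [hQ z hzm, hQ _ (hA' z hzm)] at hz'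
    exact ⟨hzm, hz'⟩
  have hc : IsCompactOperator (Q * A * Q : H →L[ℝ] H) := (hA.clm_comp Q).comp_clm Q
  obtain ⟨L, hL⟩ := isUnit_one_add_of_isCompactOperator hc fun z hz =>
    hinj z (key 0 (zero_mem _) z hz).2
  have hz : (1 + Q * A * Q) ((↑L⁻¹ : H →L[ℝ] H) x) = x := by
    have h1 : (L : H →L[ℝ] H) * ↑L⁻¹ = 1 := L.mul_inv
    rw [hL] at h1
    exact congrArg (fun T : H →L[ℝ] H => T x) h1
  obtain ⟨hm, hz2⟩ := key x hx _ hz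
  have h2 := congrArg (fun T : H →L[ℝ] H => T ((↑L⁻¹ : H →L[ℝ] H) x)) hinv
  simp only [mul_apply_eq_comp, add_apply, one_apply_eq_self, hz2] at h2
  rw [h2]
  exact hm

/-- An operator may be prescribed by square-summable values on an orthonormal basis. -/
theorem exists_apply_basis_eq {ι : Type*} (e : HilbertBasis ι ℝ H) {v : ι → H}
    (hv : Summable fun i => ‖v i‖ ^ 2) :
    ∃ A : H →L[ℝ] H, ∀ i, A (e i) = v i := by
  classical
  have hs := fun x => summable_smul_and_norm_sum_le e hv x
  let A : H →L[ℝ] H := LinearMap.mkContinuous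
    { toFun := fun x => ∑' i, ⟪e i, x⟫_ℝ • v i
      map_add' := fun x y => by
        rw [← (hs x).1.tsum_add (hs y).1]
        simp only [inner_add_right, add_smul]
      map_smul' := fun c x => by
        rw [RingHom.id_apply, ← (hs x).1.tsum_const_smul]
        simp only [inner_smul_right, mul_smul] }
    (√(∑' i, ‖v i‖ ^ 2)) fun x => (hs x).2
  refine ⟨A, fun i => ?_⟩
  refine (tsum_eq_single i fun j hj => ?_).trans ?_
  · rw [e.orthonormal.2 hj, zero_smul]
  · rw [real_inner_self_eq_norm_sq, e.orthonormal.1 i, one_pow, one_smul]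

/-- For a coercive `1 + S`, a `C` with triangular adjoint can be found such that `S + C + S C` is
triangular. The Hilbert–Schmidt operators are realized as `ℓ²(ι, H)` by their values on a basis.
Those whose adjoint is triangular form a closed subspace. It contains the rank one operators
`⟪x, ·⟫ y` with `x ∈ N q` and `y ∈ (N q)ᗮ`, because the `N q` are linearly ordered, and so an
operator orthogonal to it is triangular. Finding `C` in this subspace with `S + C + S C` orthogonal
to it is a coercive problem, as `1 + S` acts on `ℓ²(ι, H)` coordinatewise. -/
theorem exists_triangular_solution [∀ q, (N q).HasOrthogonalProjection]
    (hN : ∀ q q', N q ≤ N q' ∨ N q' ≤ N q) {S : H →L[ℝ] H} (hS : IsHilbertSchmidt S) {δ : ℝ}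
    (hδ : 0 < δ) (hpos : ∀ x, δ * ‖x‖ ^ 2 ≤ ⟪(1 + S) x, x⟫_ℝ) :
    ∃ C : H →L[ℝ] H, IsHilbertSchmidt C ∧ IsTriangular N C.adjoint ∧
      IsTriangular N (S + C + S * C) := by
  obtain ⟨ι, e, he⟩ := hS
  have hmem : ∀ v : ι → H, (Summable fun i => ‖v i‖ ^ 2) → Memℓp v 2 := fun v hv =>
    memℓp_gen (by simpa using hv)
  have hsum : ∀ v : lp (fun _ : ι => H) 2, Summable fun i => ‖v i‖ ^ 2 := fun v => by
    simpa using (lp.memℓp v).summable (by norm_num)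
  let s : lp (fun _ : ι => H) 2 := ⟨fun i => S (e i), hmem _ he⟩
  let P : lp (fun _ : ι => H) 2 →L[ℝ] lp (fun _ : ι => H) 2 :=
    lp.mapCLM 2 (fun _ => 1 + S) (norm_nonneg (1 + S)) fun _ => le_rfl
  have hPi : ∀ v i, P v i = (1 + S) (v i) := fun v i => rfl
  have hP : ∀ v, δ * ‖v‖ ^ 2 ≤ ⟪P v, v⟫_ℝ := fun v => by
    have h1 : HasSum (fun i => ⟪v i, v i⟫_ℝ) (⟪v, v⟫_ℝ) := lp.hasSum_inner v v
    simp only [real_inner_self_eq_norm_sq] at h1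
    exact hasSum_le (fun i => hpos (v i)) (h1.mul_left δ) (lp.hasSum_inner (P v) v)
  have ht : ∀ x y : H, Memℓp (fun i => ⟪e i, x⟫_ℝ • y) 2 := fun x y => hmem _ <| by
    simp only [norm_smul, mul_pow, Real.norm_eq_abs, sq_abs]
    exact (hasSum_sq_inner e x).summable.mul_right _
  let t : H → H → lp (fun _ : ι => H) 2 := fun x y => ⟨_, ht x y⟩
  -- pairing with `t x y`, the rank one operator `⟪x, ·⟫ y`, is a matrix element
  have htA : ∀ (v : lp (fun _ : ι => H) 2) (A : H →L[ℝ] H), (∀ i, A (e i) = v i) →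
      ∀ x y, ⟪v, t x y⟫_ℝ = ⟪A x, y⟫_ℝ := fun v A hA x y => by
    have h1 : HasSum (fun i => ⟪v i, ⟪e i, x⟫_ℝ • y⟫_ℝ) (⟪v, t x y⟫_ℝ) := lp.hasSum_inner v _
    have h2 : HasSum (fun i => ⟪y, A (⟪e i, x⟫_ℝ • e i)⟫_ℝ) (⟪y, A x⟫_ℝ) := by
      have := (e.hasSum_repr x).mapL (innerSL ℝ y ∘L A)
      simpa [e.repr_apply_apply, inner_smul_right] using this
    rw [real_inner_comm y (A x)]
    refine h1.unique (h2.congr_fun fun i => ?_)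
    rw [map_smul, hA, inner_smul_right, inner_smul_right, real_inner_comm (v i) y]
  let U : Submodule ℝ (lp (fun _ : ι => H) 2) :=
    (Submodule.span ℝ {w | ∃ q, ∃ x ∈ (N q)ᗮ, ∃ y ∈ N q, w = t x y})ᗮ
  have hU : ∀ v, v ∈ U ↔ ∀ q, ∀ x ∈ (N q)ᗮ, ∀ y ∈ N q, ⟪v, t x y⟫_ℝ = 0 := fun v => by
    constructor
    · intro hv q x hx y hy
      rw [real_inner_comm]
      exact hv _ (Submodule.subset_span ⟨q, x, hx, y, hy, rfl⟩)
    · intro hv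
      rw [Submodule.mem_orthogonal']
      intro w hw
      induction hw using Submodule.span_induction with
      | mem w hw =>
        obtain ⟨q, x, hx, y, hy, rfl⟩ := hw
        exact hv q x hx y hy
      | zero => simp
      | add a b _ _ ha hb => rw [inner_add_right, ha, hb, add_zero]
      | smul c a _ ha => rw [inner_smul_right, ha, mul_zero]
  obtain ⟨u, huU, hu⟩ := exists_mem_forall_inner_eq_zero hδ hP U s
  obtain ⟨C, hC⟩ := exists_apply_basis_eq e (hsum u)
  refine ⟨C, ⟨ι, e, by simpa only [hC] using hsum u⟩, fun q x hx => ?_, fun q x hx => ?_⟩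
  · rw [← Submodule.orthogonal_orthogonal (N q), Submodule.mem_orthogonal]
    intro y hy
    rw [ContinuousLinearMap.adjoint_inner_right, ← htA u C hC]
    exact (hU u).1 huU q y hy x hx
  · rw [← Submodule.orthogonal_orthogonal (N q), Submodule.mem_orthogonal']
    intro y hy
    rw [← htA (P u + s) _ fun i => ?_]
    · refine hu _ ((hU _).2 fun q' x' hx' y' hy' => ?_)
      rw [← real_inner_comm, htA (t x' y') ((innerSL ℝ x').smulRight y') fun i => ?_]
      · rw [ContinuousLinearMap.smulRight_apply, innerSL_apply_apply, inner_smul_left]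
        rcases hN q q' with hq | hq
        · rw [Submodule.inner_left_of_mem_orthogonal (hq hx) hx']
          simp
        · rw [Submodule.inner_right_of_mem_orthogonal (hq hy') hy, mul_zero]
      · rw [ContinuousLinearMap.smulRight_apply, innerSL_apply_apply, real_inner_comm]
    · rw [lp.coeFn_add, Pi.add_apply, hPi, ← hC]
      simp only [add_apply, mul_apply_eq_comp, one_apply_eq_self, s]
      abel

end Nest

/-! ### Integral operators with square-integrable kernels -/

section Kernel

variable {μ : Measure ℝ} [SFinite μ]

theorem inner_eq_integral {X : Type*} [MeasurableSpace X] {ν : Measure X} (f g : Lp ℝ 2 ν) :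
    ⟪f, g⟫_ℝ = ∫ x, f x * g x ∂ν := by
  rw [L2.inner_def]
  refine integral_congr_ae (Filter.Eventually.of_forall fun x => ?_)
  simp [mul_comm]

theorem inner_toLp_left {X : Type*} [MeasurableSpace X] {ν : Measure X} {f : X → ℝ}
    (hf : MemLp f 2 ν) (g : Lp ℝ 2 ν) : ⟪hf.toLp f, g⟫_ℝ = ∫ x, f x * g x ∂ν := by
  rw [inner_eq_integral]
  refine integral_congr_ae ?_
  filter_upwards [hf.coeFn_toLp] with x hx
  rw [hx]

theorem norm_sq_toLp {X : Type*} [MeasurableSpace X] {ν : Measure X} {f : X → ℝ}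
    (hf : MemLp f 2 ν) : ‖hf.toLp f‖ ^ 2 = ∫ x, f x ^ 2 ∂ν := by
  rw [← real_inner_self_eq_norm_sq, inner_toLp_left]
  refine integral_congr_ae ?_
  filter_upwards [hf.coeFn_toLp] with x hx
  rw [hx, sq]

theorem memLp_row {k : ℝ → ℝ → ℝ} (hk : MemLp (Function.uncurry k) 2 (μ.prod μ)) :
    ∀ᵐ x ∂μ, MemLp (k x) 2 μ := by
  filter_upwards [hk.integrable_sq.prod_right_ae, hk.1.prodMk_left] with x h1 h2
  exact (memLp_two_iff_integrable_sq h2).2 h1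

theorem memLp_transpose {k : ℝ → ℝ → ℝ} (hk : MemLp (Function.uncurry k) 2 (μ.prod μ)) :
    MemLp (Function.uncurry fun x y => k y x) 2 (μ.prod μ) :=
  hk.comp_measurePreserving Measure.measurePreserving_swap

theorem memLp_tensor {f g : ℝ → ℝ} (hf : MemLp f 2 μ) (hg : MemLp g 2 μ) :
    MemLp (fun z : ℝ × ℝ => f z.1 * g z.2) 2 (μ.prod μ) := by
  have hm : AEStronglyMeasurable (fun z : ℝ × ℝ => f z.1 * g z.2) (μ.prod μ) :=
    hf.1.comp_fst.mul hg.1.comp_snd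
  rw [memLp_two_iff_integrable_sq hm]
  simpa only [mul_pow] using hf.integrable_sq.mul_prod hg.integrable_sq

theorem memLp_integral_mul {k : ℝ → ℝ → ℝ} (hk : MemLp (Function.uncurry k) 2 (μ.prod μ))
    (φ : Lp ℝ 2 μ) : MemLp (fun x => ∫ y, k x y * φ y ∂μ) 2 μ := by
  have hm : AEStronglyMeasurable (fun x => ∫ y, k x y * φ y ∂μ) μ :=
    AEStronglyMeasurable.integral_prod_right' (hk.1.mul (Lp.memLp φ).1.comp_snd)
  rw [memLp_two_iff_integrable_sq hm]
  refine (hk.integrable_sq.integral_prod_left.mul_const (‖φ‖ ^ 2)).mono' (hm.pow 2) ?_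
  filter_upwards [memLp_row hk] with x hx
  rw [Real.norm_eq_abs, abs_of_nonneg (sq_nonneg _), ← inner_toLp_left hx, ← sq_abs]
  have h := abs_real_inner_le_norm (hx.toLp _) φ
  calc |⟪hx.toLp _, φ⟫_ℝ| ^ 2 ≤ (‖hx.toLp _‖ * ‖φ‖) ^ 2 := by gcongr
    _ = _ := by rw [mul_pow, norm_sq_toLp]; rfl

/-- Pairing of a kernel with a product function. -/
theorem integral_kernel_mul_tensor {k : ℝ → ℝ → ℝ}
    (hk : MemLp (Function.uncurry k) 2 (μ.prod μ)) (ψ φ : Lp ℝ 2 μ) :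
    ∫ z, k z.1 z.2 * (ψ z.1 * φ z.2) ∂(μ.prod μ) = ∫ x, (∫ y, k x y * φ y ∂μ) * ψ x ∂μ := by
  have hi : Integrable (fun z : ℝ × ℝ => k z.1 z.2 * (ψ z.1 * φ z.2)) (μ.prod μ) :=
    hk.integrable_mul (memLp_tensor (Lp.memLp ψ) (Lp.memLp φ))
  rw [integral_prod _ hi]
  refine integral_congr_ae (Filter.Eventually.of_forall fun x => ?_)
  simp only [← integral_mul_const]
  refine integral_congr_ae (Filter.Eventually.of_forall fun y => ?_)
  simp only
  ring

theorem HasKernel.inner_apply {A : Lp ℝ 2 μ →L[ℝ] Lp ℝ 2 μ} {k : ℝ → ℝ → ℝ}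
    (h : HasKernel μ A k) (ψ φ : Lp ℝ 2 μ) :
    ⟪A φ, ψ⟫_ℝ = ∫ z, k z.1 z.2 * (ψ z.1 * φ z.2) ∂(μ.prod μ) := by
  rw [integral_kernel_mul_tensor h.1, inner_eq_integral]
  refine integral_congr_ae ?_
  filter_upwards [h.2 φ] with x hx
  rw [hx]

/-- A kernel of `A` may be recognized by matrix elements. -/
theorem hasKernel_of_inner {A : Lp ℝ 2 μ →L[ℝ] Lp ℝ 2 μ} {k : ℝ → ℝ → ℝ}
    (hk : MemLp (Function.uncurry k) 2 (μ.prod μ))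
    (h : ∀ ψ φ : Lp ℝ 2 μ, ⟪A φ, ψ⟫_ℝ = ∫ z, k z.1 z.2 * (ψ z.1 * φ z.2) ∂(μ.prod μ)) :
    HasKernel μ A k := by
  refine ⟨hk, fun φ => ?_⟩
  have h1 : A φ = (memLp_integral_mul hk φ).toLp _ := by
    refine ext_inner_right ℝ fun ψ => ?_
    rw [h, inner_toLp_left, integral_kernel_mul_tensor hk]
  rw [h1]
  exact (memLp_integral_mul hk φ).coeFn_toLp

theorem HasKernel.adjoint {A : Lp ℝ 2 μ →L[ℝ] Lp ℝ 2 μ} {k : ℝ → ℝ → ℝ}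
    (h : HasKernel μ A k) : HasKernel μ A.adjoint fun x y => k y x := by
  refine hasKernel_of_inner (memLp_transpose h.1) fun ψ φ => ?_
  rw [ContinuousLinearMap.adjoint_inner_left, real_inner_comm, h.inner_apply,
    ← integral_prod_swap]
  refine integral_congr_ae (Filter.Eventually.of_forall fun z => ?_)
  simp only [Prod.fst_swap, Prod.snd_swap]
  ring

/-- The matrix coefficients of an integral operator against an orthonormal basis are controlled by
Bessel's inequality for almost every row of the kernel. -/
theorem HasKernel.isHilbertSchmidt {A : Lp ℝ 2 μ →L[ℝ] Lp ℝ 2 μ} {k : ℝ → ℝ → ℝ}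
    (h : HasKernel μ A k) : IsHilbertSchmidt A := by
  obtain ⟨ι, ⟨e⟩⟩ := exists_hilbertBasis_type (Lp ℝ 2 μ)
  refine ⟨ι, e, summable_of_sum_le (c := ∫ x, ∫ y, k x y ^ 2 ∂μ ∂μ)
    (fun i => sq_nonneg _) fun F => ?_⟩
  have h1 : ∀ i, ‖A (e i)‖ ^ 2 = ∫ x, (∫ y, k x y * e i y ∂μ) ^ 2 ∂μ := fun i => by
    rw [← norm_sq_toLp (memLp_integral_mul h.1 (e i))]
    congr 2
    refine Lp.ext ?_
    filter_upwards [h.2 (e i), (memLp_integral_mul h.1 (e i)).coeFn_toLp] with x hx hx'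
    rw [hx, hx']
  simp only [h1]
  rw [← integral_finsetSum _ fun i _ => (memLp_integral_mul h.1 (e i)).integrable_sq]
  refine integral_mono_ae
    (integrable_finsetSum _ fun i _ => (memLp_integral_mul h.1 (e i)).integrable_sq)
    h.1.integrable_sq.integral_prod_left ?_
  filter_upwards [memLp_row h.1] with x hx
  simp only [← inner_toLp_left hx, ← norm_sq_toLp hx]
  refine le_trans (le_of_eq (Finset.sum_congr rfl fun i _ => ?_))
    (e.orthonormal.sum_inner_products_le (hx.toLp (k x)) (s := F))
  rw [real_inner_comm, Real.norm_eq_abs, sq_abs]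

/-- The isometry `f ↦ f ⊗ g` of `L²(μ)` into `L²(μ × μ)`, for a unit vector `g`. -/
def tensorUnit (g : Lp ℝ 2 μ) (hg : ‖g‖ = 1) : Lp ℝ 2 μ →ₗᵢ[ℝ] Lp ℝ 2 (μ.prod μ) where
  toFun f := (memLp_tensor (Lp.memLp f) (Lp.memLp g)).toLp _
  map_add' f f' := by
    rw [← MemLp.toLp_add, MemLp.toLp_eq_toLp_iff]
    have h := (Measure.quasiMeasurePreserving_fst (μ := μ) (ν := μ)).ae (Lp.coeFn_add f f')
    filter_upwards [h] with z hz
    simp only [hz, Pi.add_apply, add_mul]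
  map_smul' c f := by
    rw [RingHom.id_apply, ← MemLp.toLp_const_smul, MemLp.toLp_eq_toLp_iff]
    have h := (Measure.quasiMeasurePreserving_fst (μ := μ) (ν := μ)).ae (Lp.coeFn_smul c f)
    filter_upwards [h] with z hz
    simp only [hz, Pi.smul_apply, smul_eq_mul, mul_assoc]
  norm_map' f := by
    have hg' : ∫ y, g y * g y ∂μ = 1 := by
      rw [← inner_eq_integral, real_inner_self_eq_norm_sq, hg, one_pow]
    rw [← sq_eq_sq₀ (norm_nonneg _) (norm_nonneg _)]
    refine (norm_sq_toLp (memLp_tensor (Lp.memLp f) (Lp.memLp g))).trans ?_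
    simp only [mul_pow]
    rw [integral_prod_mul (fun x => f x ^ 2) fun y => g y ^ 2]
    simp only [sq]
    rw [hg', mul_one, ← inner_eq_integral, real_inner_self_eq_norm_mul_norm]

theorem inner_tensorUnit (f g : Lp ℝ 2 μ) (hg : ‖g‖ = 1) (ψ φ : Lp ℝ 2 μ) :
    ⟪tensorUnit g hg f, (memLp_tensor (Lp.memLp ψ) (Lp.memLp φ)).toLp _⟫_ℝ
      = ⟪f, ψ⟫_ℝ * ⟪g, φ⟫_ℝ := by
  refine (inner_toLp_left (memLp_tensor (Lp.memLp f) (Lp.memLp g)) _).trans ?_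
  rw [inner_eq_integral, inner_eq_integral, ← integral_prod_mul]
  refine integral_congr_ae ?_
  filter_upwards [(memLp_tensor (Lp.memLp ψ) (Lp.memLp φ)).coeFn_toLp] with z hz
  rw [hz]
  ring

/-- A Hilbert–Schmidt operator is an integral operator, with kernel `∑ (A eᵢ)(x) eᵢ(y)`. -/
theorem IsHilbertSchmidt.exists_hasKernel {A : Lp ℝ 2 μ →L[ℝ] Lp ℝ 2 μ}
    (hA : IsHilbertSchmidt A) :
    ∃ k : ℝ → ℝ → ℝ, Measurable (Function.uncurry k) ∧ HasKernel μ A k := by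
  obtain ⟨ι, e, he⟩ := hA
  have hV : OrthogonalFamily ℝ (fun _ : ι => Lp ℝ 2 μ)
      fun i => tensorUnit (e i) (e.orthonormal.1 i) := fun i j hij v w => by
    refine (inner_tensorUnit v (e i) (e.orthonormal.1 i) w (e j)).trans ?_
    rw [e.orthonormal.2 hij, mul_zero]
  obtain ⟨κ, hκ⟩ := (hV.summable_iff_norm_sq_summable fun i => A (e i)).2 he
  refine ⟨fun x y => κ (x, y), (Lp.stronglyMeasurable κ).measurable,
    hasKernel_of_inner (Lp.memLp κ) fun ψ φ => ?_⟩
  let t := (memLp_tensor (Lp.memLp ψ) (Lp.memLp φ)).toLp _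
  have h1 : HasSum (fun i => ⟪A (e i), ψ⟫_ℝ * ⟪e i, φ⟫_ℝ) ⟪t, κ⟫_ℝ := by
    refine (hκ.mapL (innerSL ℝ t)).congr_fun fun i => ?_
    rw [innerSL_apply_apply]
    exact (inner_tensorUnit _ _ _ _ _).symm.trans (real_inner_comm _ _)
  have h2 : HasSum (fun i => ⟪A (e i), ψ⟫_ℝ * ⟪e i, φ⟫_ℝ) ⟪ψ, A φ⟫_ℝ := by
    refine ((e.hasSum_repr φ).mapL (innerSL ℝ ψ ∘L A)).congr_fun fun i => ?_
    simp [e.repr_apply_apply, real_inner_comm ψ, mul_comm]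
  rw [real_inner_comm, h2.unique h1, inner_toLp_left]
  refine integral_congr_ae (Filter.Eventually.of_forall fun z => ?_)
  simp only
  ring

end Kernel

/-! ### The nest of half-line subspaces and the Volterra algebra -/

section Volterra

/-- The subspace `L²(q, ∞)` of `L²(ℝ)`: the functions that vanish on `(-∞, q)`. -/
def tail (q : ℝ) : Submodule ℝ L2R := (restrictL2 q).ker

theorem mem_tail {q : ℝ} {φ : L2R} : φ ∈ tail q ↔ restrictL2 q φ = 0 := Iff.rfl

theorem mem_tail_iff {q : ℝ} {φ : L2R} : φ ∈ tail q ↔ ∀ᵐ x, x < q → φ x = 0 := by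
  have h1 := LpToLpRestrictCLM_coeFn (𝕜 := ℝ) (Set.Iio q) φ
  have h2 : (∀ᵐ x, x < q → φ x = 0) ↔ ∀ᵐ x ∂(volume.restrict (Set.Iio q)), φ x = 0 :=
    (ae_restrict_iff' measurableSet_Iio).symm
  rw [mem_tail, Lp.eq_zero_iff_ae_eq_zero, h2]
  constructor
  · intro h
    filter_upwards [h, h1] with x hx hx'
    exact hx'.symm.trans hx
  · intro h
    filter_upwards [h, h1] with x hx hx'
    exact hx'.trans hx

instance (q : ℝ) : (tail q).HasOrthogonalProjection := by
  have : CompleteSpace (tail q) := (restrictL2 q).isClosed_ker.completeSpace_coe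
  infer_instance

theorem tail_total (q q' : ℝ) : tail q ≤ tail q' ∨ tail q' ≤ tail q := by
  have h : ∀ {a b : ℝ}, a ≤ b → tail b ≤ tail a := fun hab φ hφ => by
    rw [mem_tail_iff] at hφ ⊢
    filter_upwards [hφ] with x hx hxa
    exact hx (hxa.trans_le hab)
  rcases le_total q q' with hq | hq
  · exact Or.inr (h hq)
  · exact Or.inl (h hq)

theorem restrictL2_adjoint_apply (y : ℝ) (φ : L2Iio y) :
    restrictL2 y ((restrictL2 y).adjoint φ) = φ :=
  congrArg (fun T : L2Iio y →L[ℝ] L2Iio y => T φ) (trunc_one y)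

theorem adjoint_restrictL2_apply (q : ℝ) (φ : L2R) :
    ((restrictL2 q).adjoint (restrictL2 q φ) : ℝ → ℝ) =ᵐ[volume] (Set.Iio q).indicator φ := by
  have h1 := LpToLpRestrictCLM_coeFn (𝕜 := ℝ) (Set.Iio q) φ
  rw [Filter.EventuallyEq, ae_restrict_iff' measurableSet_Iio] at h1
  filter_upwards [adjoint_restrictL2 q (restrictL2 q φ), h1] with x hx hx'
  rw [hx]
  by_cases hq : x ∈ Set.Iio q
  · rw [Set.indicator_of_mem hq, Set.indicator_of_mem hq]
    exact hx' hq
  · rw [Set.indicator_of_notMem hq, Set.indicator_of_notMem hq]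

theorem sub_adjoint_restrictL2_mem_tail (q : ℝ) (φ : L2R) :
    φ - (restrictL2 q).adjoint (restrictL2 q φ) ∈ tail q := by
  rw [mem_tail, map_sub, restrictL2_adjoint_apply, sub_self]

/-- The kernel of a triangular integral operator vanishes above the diagonal: for rational `q > x`
the row `k x` is orthogonal to the projections to `L²(q, ∞)` of a dense sequence, hence vanishes
on `(q, ∞)`. -/
theorem HasKernel.ae_eq_zero {A : L2R →L[ℝ] L2R} {k : ℝ → ℝ → ℝ} (h : HasKernel volume A k)
    (hA : IsTriangular tail A) :
    ∀ᵐ x : ℝ, ∀ᵐ y ∂(volume.restrict (Set.Ioi x)), k x y = 0 := by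
  have : Fact ((1 : ENNReal) ≤ 2) := ⟨one_le_two⟩
  have : Fact ((2 : ENNReal) ≠ ⊤) := ⟨ENNReal.ofNat_ne_top⟩
  let D : ℕ → L2R := TopologicalSpace.denseSeq L2R
  let cut : ℝ → L2R →L[ℝ] L2R := fun q => 1 - (restrictL2 q).adjoint ∘L restrictL2 q
  have hcut : ∀ q f, cut q f = f - (restrictL2 q).adjoint (restrictL2 q f) := fun q f => rfl
  have h1 : ∀ᵐ x : ℝ, ∀ (q : ℚ) (n : ℕ), x < q → ∫ y, k x y * cut q (D n) y = 0 := by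
    rw [ae_all_iff]
    intro q
    rw [ae_all_iff]
    intro n
    have hm := mem_tail_iff.1 (hA q _ (sub_adjoint_restrictL2_mem_tail q (D n)))
    filter_upwards [hm, h.2 (cut q (D n))] with x hx hx' hxq
    rw [← hx']
    exact hx hxq
  filter_upwards [h1, memLp_row h.1] with x hx hrow
  have h2 : ∀ q : ℚ, x < q → ∀ᵐ y : ℝ, (q : ℝ) ≤ y → k x y = 0 := fun q hq => by
    have h3 : ∀ f : L2R, ⟪hrow.toLp _, cut q f⟫_ℝ = 0 := fun f => by
      refine (TopologicalSpace.denseRange_denseSeq L2R).induction_on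
        (p := fun f => ⟪hrow.toLp _, cut q f⟫_ℝ = 0) f ?_ fun n => ?_
      · exact isClosed_eq (continuous_const.inner (cut q).continuous) continuous_const
      · rw [inner_toLp_left]
        exact hx q n hq
    have h4 : cut q (hrow.toLp _) = 0 := by
      refine ext_inner_right ℝ fun f => ?_
      rw [inner_zero_left, ← h3 f, hcut, hcut, inner_sub_left, inner_sub_right,
        ContinuousLinearMap.adjoint_inner_left, ContinuousLinearMap.adjoint_inner_right]
    rw [hcut, sub_eq_zero] at h4
    have h5 := adjoint_restrictL2_apply q (hrow.toLp _)
    rw [← h4] at h5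
    filter_upwards [h5, hrow.coeFn_toLp] with y hy hy' hqy
    rw [← hy', hy, Set.indicator_of_notMem (by simpa using hqy)]
  rw [ae_restrict_iff' measurableSet_Ioi]
  have h6 : ∀ᵐ y : ℝ, ∀ q : ℚ, x < q → (q : ℝ) ≤ y → k x y = 0 := by
    rw [ae_all_iff]
    intro q
    by_cases hq : x < q
    · filter_upwards [h2 q hq] with y hy _ using hy
    · exact Filter.Eventually.of_forall fun y hq' => absurd hq' hq
  filter_upwards [h6] with y hy hxy
  obtain ⟨q, hq, hq'⟩ := exists_rat_btwn (Set.mem_Ioi.1 hxy)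
  exact hy q hq hq'.le

theorem exists_hasKernel_of_mem_lowerAlgebra {A : L2R →L[ℝ] L2R} (hA : A ∈ lowerAlgebra) :
    ∃ k : ℝ → ℝ → ℝ, HasKernel volume A k ∧ ∀ x y, x ≤ y → k x y = 0 := by
  obtain ⟨a, ha, hA⟩ := hA
  have hms : MeasurableSet {z : ℝ × ℝ | z.2 < z.1} := measurableSet_lt measurable_snd measurable_fst
  refine ⟨fun x y => {z : ℝ × ℝ | z.2 < z.1}.indicator (Function.uncurry a) (x, y),
    ⟨ha.indicator hms, fun φ => ?_⟩, fun x y hxy => ?_⟩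
  · filter_upwards [hA φ] with x hx
    rw [hx, ← integral_indicator measurableSet_Iio]
    refine integral_congr_ae (Filter.Eventually.of_forall fun y => ?_)
    by_cases hy : y < x <;> simp [Set.indicator, hy]
  · simp [Set.indicator, hxy]

theorem isTriangular_of_mem_lowerAlgebra {A : L2R →L[ℝ] L2R} (hA : A ∈ lowerAlgebra) :
    IsTriangular tail A := by
  obtain ⟨a, -, hA⟩ := hA
  intro q φ hφ
  rw [mem_tail_iff] at hφ ⊢
  filter_upwards [hA φ] with x hx hxq
  rw [hx, ← integral_indicator measurableSet_Iio]
  refine (integral_congr_ae ?_).trans (integral_zero ℝ ℝ)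
  filter_upwards [hφ] with y hy
  by_cases hyx : y < x
  · simp [Set.indicator, hy (hyx.trans hxq)]
  · simp [Set.indicator, hyx]

theorem isHilbertSchmidt_of_mem_lowerAlgebra {A : L2R →L[ℝ] L2R} (hA : A ∈ lowerAlgebra) :
    IsHilbertSchmidt A := by
  obtain ⟨k, hk, -⟩ := exists_hasKernel_of_mem_lowerAlgebra hA
  exact hk.isHilbertSchmidt

theorem mem_lowerAlgebra_of_isTriangular {A : L2R →L[ℝ] L2R} (hA : IsHilbertSchmidt A)
    (hT : IsTriangular tail A) : A ∈ lowerAlgebra := by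
  obtain ⟨k, -, hk⟩ := hA.exists_hasKernel
  refine ⟨k, hk.1, fun φ => ?_⟩
  filter_upwards [hk.2 φ, hk.ae_eq_zero hT] with x hx hx'
  rw [hx, ← setIntegral_univ, ← Set.Iic_union_Ioi (a := x)]
  rw [ae_restrict_iff' measurableSet_Ioi] at hx'
  rw [← integral_indicator (measurableSet_Iic.union measurableSet_Ioi),
    ← integral_indicator measurableSet_Iio]
  refine integral_congr_ae ?_
  filter_upwards [hx', compl_mem_ae_iff.2 (measure_singleton x)] with y hy hyx
  rcases lt_or_gt_of_ne (show y ≠ x from hyx) with h | h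
  · simp [Set.indicator, h]
  · simp [Set.indicator, h.not_gt, hy h]

/-- A Hilbert–Schmidt operator that is both lower and upper triangular is zero: its kernel is
supported on the diagonal. -/
theorem eq_zero_of_isTriangular_adjoint {A : L2R →L[ℝ] L2R} (hA : IsHilbertSchmidt A)
    (h : IsTriangular tail A) (h' : IsTriangular tail A.adjoint) : A = 0 := by
  obtain ⟨k, hkm, hk⟩ := hA.exists_hasKernel
  have h1 := hk.ae_eq_zero h
  have h2 := hk.adjoint.ae_eq_zero h'
  simp only [ae_restrict_iff' measurableSet_Ioi] at h1 h2
  have hms : MeasurableSet {z : ℝ × ℝ | z.1 ∈ Set.Ioi z.2 → k z.1 z.2 = 0} := by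
    have h3 : MeasurableSet {z : ℝ × ℝ | z.2 < z.1} :=
      measurableSet_lt measurable_snd measurable_fst
    have h4 : MeasurableSet {z : ℝ × ℝ | k z.1 z.2 = 0} := hkm (measurableSet_singleton 0)
    exact h3.imp h4
  rw [← Measure.ae_ae_comm hms] at h2
  ext1 φ
  refine Lp.ext ?_
  filter_upwards [hk.2 φ, h1, h2, Lp.coeFn_zero ℝ 2 (volume : Measure ℝ)] with x hx h1x h2x h0
  rw [hx]
  refine Eq.trans ?_ h0.symm
  refine (integral_congr_ae ?_).trans (integral_zero ℝ ℝ)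
  filter_upwards [h1x, h2x, compl_mem_ae_iff.2 (measure_singleton x)] with y hy1 hy2 hyx
  rcases lt_or_gt_of_ne (show y ≠ x from hyx) with h | h
  · rw [hy2 h, zero_mul]
  · rw [hy1 h, zero_mul]

end Volterra

/-! ### The Cauchy–Binet formula -/

section CauchyBinet

theorem det_sum_eq_sum_piFinset {R I κ : Type*} [CommRing R] [Fintype I] [DecidableEq I]
    [DecidableEq κ] (u v : κ → I → R) (F : Finset κ) :
    (Matrix.of fun i j => ∑ l ∈ F, u l i * v l j).det =
      ∑ p ∈ Fintype.piFinset fun _ : I => F, (Matrix.of fun i j => u (p i) i * v (p i) j).det := by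
  have h := Matrix.detRowAlternating.toMultilinearMap.map_sum_finset
    (fun (i : I) (l : κ) (j : I) => u l i * v l j) fun _ => F
  refine Eq.trans ?_ h
  refine congrArg Matrix.det ?_
  ext i j
  simp [Finset.sum_apply]

/-- Cauchy–Binet, written without choosing an order of the summation index: the determinant of a
sum of rank one matrices is the sum of the determinants of the partial sums of `|I|` terms. -/
theorem det_sum_eq_sum_powersetCard {R I κ : Type*} [CommRing R] [Fintype I] [DecidableEq I]
    [DecidableEq κ] (u v : κ → I → R) (F : Finset κ) :
    (Matrix.of fun i j => ∑ l ∈ F, u l i * v l j).det =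
      ∑ J ∈ F.powersetCard (Fintype.card I),
        (Matrix.of fun i j => ∑ l ∈ J, u l i * v l j).det := by
  classical
  simp only [det_sum_eq_sum_piFinset]
  set X : (I → κ) → R := fun p => (Matrix.of fun i j => u (p i) i * v (p i) j).det
  have h0 : ∀ p : I → κ, ¬ Function.Injective p → X p = 0 := fun p hp => by
    obtain ⟨i, j, hij, hne⟩ : ∃ i j, p i = p j ∧ i ≠ j := by
      simpa [Function.Injective] using hp
    have h1 := Matrix.det_mul_column (fun i => u (p i) i) (Matrix.of fun i j => v (p i) j)
    simp only [Matrix.of_apply] at h1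
    change (Matrix.of fun i j => u (p i) i * v (p i) j).det = 0
    rw [h1, Matrix.det_zero_of_row_eq hne (by ext l; simp [hij]), mul_zero]
  have hinj : ∀ G : Finset κ, ∑ p ∈ Fintype.piFinset fun _ : I => G, X p =
      ∑ p ∈ Fintype.piFinset fun _ : I => G with Function.Injective p, X p := fun G => by
    refine (Finset.sum_filter_of_ne fun p _ hp => ?_).symm
    by_contra hc
    exact hp (h0 p hc)
  simp only [hinj]
  rw [← Finset.sum_fiberwise_of_maps_to (g := fun p : I → κ => Finset.univ.image p)
    (t := F.powersetCard (Fintype.card I))]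
  · refine Finset.sum_congr rfl fun J hJ => Finset.sum_congr ?_ fun _ _ => rfl
    rw [Finset.mem_powersetCard] at hJ
    ext p
    simp only [Finset.mem_filter, Fintype.mem_piFinset]
    constructor
    · rintro ⟨⟨-, hp⟩, rfl⟩
      exact ⟨fun i => Finset.mem_image_of_mem p (Finset.mem_univ i), hp⟩
    · rintro ⟨h1, hp⟩
      refine ⟨⟨fun i => hJ.1 (h1 i), hp⟩, Finset.eq_of_subset_of_card_le ?_ ?_⟩
      · intro l hl
        obtain ⟨i, -, rfl⟩ := Finset.mem_image.1 hl
        exact h1 i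
      · rw [hJ.2, Finset.card_image_of_injective _ hp, Finset.card_univ]
  · intro p hp
    simp only [Finset.mem_filter, Fintype.mem_piFinset] at hp
    rw [Finset.mem_powersetCard, Finset.card_image_of_injective _ hp.2, Finset.card_univ]
    refine ⟨fun l hl => ?_, rfl⟩
    obtain ⟨i, -, rfl⟩ := Finset.mem_image.1 hl
    exact hp.1 i

variable {ι κ : Type*} [DecidableEq ι] [DecidableEq κ]

/-- The square of the minor of `a` with rows `I` and columns `J`, `|I| = |J|`. It is written as
the determinant of the product of this submatrix with its transpose, so that no bijection between
`I` and `J` has to be chosen. -/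
def minorSq (a : ι → κ → ℝ) (I : Finset ι) (J : Finset κ) : ℝ :=
  (Matrix.of fun i j : I => ∑ l ∈ J, a i l * a j l).det

theorem det_sum_weighted_eq (a : ι → κ → ℝ) (w : κ → ℝ) {I : Finset ι} {J : Finset κ}
    (e : I ≃ J) :
    (Matrix.of fun i j : I => ∑ l ∈ J, (w l * a i l) * a j l).det =
      (∏ l ∈ J, w l) * (Matrix.of fun i j : I => a i (e j)).det ^ 2 := by
  have h : (Matrix.of fun i j : I => ∑ l ∈ J, (w l * a i l) * a j l) =
      (Matrix.of fun i j : I => a i (e j)) * Matrix.diagonal (fun i => w (e i)) *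
        (Matrix.of fun i j : I => a i (e j)).transpose := by
    ext i j
    rw [Matrix.mul_apply]
    simp only [Matrix.mul_diagonal, Matrix.of_apply, Matrix.transpose_apply]
    rw [← Finset.sum_coe_sort J, ← e.sum_comp]
    exact Finset.sum_congr rfl fun l _ => by ring
  rw [h, Matrix.det_mul, Matrix.det_mul, Matrix.det_transpose, Matrix.det_diagonal,
    ← Finset.prod_coe_sort J, ← e.prod_comp]
  ring

theorem minorSq_eq_sq (a : ι → κ → ℝ) {I : Finset ι} {J : Finset κ} (e : I ≃ J) :
    minorSq a I J = (Matrix.of fun i j : I => a i (e j)).det ^ 2 := by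
  simpa [minorSq] using det_sum_weighted_eq a 1 e

theorem minorSq_nonneg (a : ι → κ → ℝ) {I : Finset ι} {J : Finset κ} (h : I.card = J.card) :
    0 ≤ minorSq a I J := by
  rw [minorSq_eq_sq a (Finset.equivOfCardEq h)]
  positivity

theorem minorSq_flip (a : ι → κ → ℝ) {I : Finset ι} {J : Finset κ} (h : I.card = J.card) :
    minorSq (fun l i => a i l) J I = minorSq a I J := by
  let e := Finset.equivOfCardEq h
  rw [minorSq_eq_sq a e, minorSq_eq_sq _ e.symm, ← Matrix.det_submatrix_equiv_self e,
    ← Matrix.det_transpose]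
  congr 2
  ext i j
  simp

theorem det_sum_weighted_eq_mul_minorSq (a : ι → κ → ℝ) (w : κ → ℝ) {I : Finset ι} {J : Finset κ}
    (h : I.card = J.card) :
    (Matrix.of fun i j : I => ∑ l ∈ J, (w l * a i l) * a j l).det =
      (∏ l ∈ J, w l) * minorSq a I J := by
  rw [det_sum_weighted_eq a w (Finset.equivOfCardEq h), minorSq_eq_sq]

/-- A nonnegative series over the `k`-element subsets may be summed along the families of all
`k`-element subsets of larger and larger finite sets. -/
theorem hasSum_of_tendsto_powersetCard {k : ℕ} {g : Finset κ → ℝ}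
    (hg : ∀ J, J.card = k → 0 ≤ g J) {a : ℝ}
    (h : Filter.Tendsto (fun F : Finset κ => ∑ J ∈ F.powersetCard k, g J) Filter.atTop (nhds a)) :
    HasSum (fun J : {J : Finset κ // J.card = k} => g J) a := by
  let Φ : Finset κ → Finset {J : Finset κ // J.card = k} := fun F =>
    F.powerset.subtype fun J => J.card = k
  have hΦ : ∀ F, ∑ J ∈ Φ F, g J = ∑ J ∈ F.powersetCard k, g J := fun F => by
    rw [Finset.powersetCard_eq_filter, Finset.sum_subtype_eq_sum_filter]
  have hmono : Monotone Φ := fun F G hFG =>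
    Finset.subtype_mono (Finset.powerset_mono.2 hFG)
  have hmem : ∀ J : {J : Finset κ // J.card = k}, J ∈ Φ J.1 := fun J => by simp [Φ]
  have htop : Filter.Tendsto Φ Filter.atTop Filter.atTop :=
    Filter.tendsto_atTop_finset_of_monotone hmono fun J => ⟨J.1, hmem J⟩
  simp only [← hΦ] at h
  have hsmono : Monotone fun F => ∑ J ∈ Φ F, g J := fun F G hFG =>
    Finset.sum_le_sum_of_subset_of_nonneg (hmono hFG) fun J _ _ => hg J J.2
  have hs : Summable fun J : {J : Finset κ // J.card = k} => g J := by
    refine summable_of_sum_le (c := a) (fun J => hg J J.2) fun s => ?_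
    refine le_trans ?_ (hsmono.ge_of_tendsto h (s.sup fun J => J.1))
    refine Finset.sum_le_sum_of_subset_of_nonneg (fun J hJ => ?_) fun J _ _ => hg J J.2
    exact hmono (Finset.le_sup (f := fun J : {J : Finset κ // J.card = k} => J.1) hJ) (hmem J)
  have h2 := tendsto_nhds_unique h (hs.hasSum.comp htop)
  rw [h2]
  exact hs.hasSum

end CauchyBinet

/-! ### Fredholm determinants of diagonalizable operators -/

section Fredholm

variable {H : Type u} [NormedAddCommGroup H] [InnerProductSpace ℝ H] [CompleteSpace H]

theorem principalMinor_eq {ι : Type u} [DecidableEq ι] (e : HilbertBasis ι ℝ H) (T : H →L[ℝ] H)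
    (I : Finset ι) :
    principalMinor e T I = (Matrix.of fun i j : I => ⟪e i, T (e j)⟫_ℝ).det := by
  unfold principalMinor
  congr!

theorem principalMinor_one {ι : Type u} (e : HilbertBasis ι ℝ H) (I : Finset ι) :
    principalMinor e 1 I = 1 := by
  classical
  rw [principalMinor_eq]
  convert Matrix.det_one (n := I) (R := ℝ)
  ext i j
  rw [Matrix.of_apply, one_apply_eq_self, orthonormal_iff_ite.1 e.orthonormal, Matrix.one_apply]
  by_cases hij : i = j
  · rw [if_pos hij, if_pos (congrArg _ hij)]
  · rw [if_neg hij, if_neg fun h => hij (Subtype.ext h)]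

theorem principalMinor_neg {ι : Type u} (e : HilbertBasis ι ℝ H) (T : H →L[ℝ] H) (I : Finset ι) :
    principalMinor e (-T) I = (-1) ^ I.card * principalMinor e T I := by
  classical
  have h := Matrix.det_neg (Matrix.of fun i j : I => ⟪e i, T (e j)⟫_ℝ)
  rw [Fintype.card_coe] at h
  rw [principalMinor_eq, principalMinor_eq, ← h]
  congr 1
  ext i j
  simp

/-- The matrix of a diagonalizable operator in another basis. -/
theorem hasSum_matrix_of_diagonal {ι κ : Type u} (e : HilbertBasis ι ℝ H)
    (f : HilbertBasis κ ℝ H) {T : H →L[ℝ] H} {w : κ → ℝ} (hT : ∀ l, T (f l) = w l • f l)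
    (i j : ι) :
    HasSum (fun l => (w l * ⟪e i, f l⟫_ℝ) * ⟪e j, f l⟫_ℝ) ⟪e i, T (e j)⟫_ℝ := by
  refine ((f.hasSum_repr (e j)).mapL (innerSL ℝ (e i) ∘L T)).congr_fun fun l => ?_
  simp [f.repr_apply_apply, hT, real_inner_comm (e j) (f l)]
  ring

/-- Cauchy–Binet for a diagonalizable operator with nonnegative eigenvalues. -/
theorem hasSum_principalMinor {ι κ : Type u} [DecidableEq ι] [DecidableEq κ]
    (e : HilbertBasis ι ℝ H) (f : HilbertBasis κ ℝ H) {T : H →L[ℝ] H} {w : κ → ℝ}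
    (hw : ∀ l, 0 ≤ w l) (hT : ∀ l, T (f l) = w l • f l) {k : ℕ} {I : Finset ι} (hI : I.card = k) :
    HasSum (fun J : {J : Finset κ // J.card = k} =>
      (∏ l ∈ J.1, w l) * minorSq (fun i l => ⟪e i, f l⟫_ℝ) I J.1) (principalMinor e T I) := by
  refine hasSum_of_tendsto_powersetCard
    (g := fun J => (∏ l ∈ J, w l) * minorSq (fun i l => ⟪e i, f l⟫_ℝ) I J)
    (fun J hJ => mul_nonneg (Finset.prod_nonneg fun l _ => hw l)
      (minorSq_nonneg _ (hI.trans hJ.symm))) ?_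
  have hF : ∀ F : Finset κ, ∑ J ∈ F.powersetCard k,
      (∏ l ∈ J, w l) * minorSq (fun i l => ⟪e i, f l⟫_ℝ) I J =
      (Matrix.of fun i j : I => ∑ l ∈ F, (w l * ⟪e i, f l⟫_ℝ) * ⟪e j, f l⟫_ℝ).det := fun F => by
    have h := det_sum_eq_sum_powersetCard (fun l (i : I) => w l * ⟪e i, f l⟫_ℝ)
      (fun l (i : I) => ⟪e i, f l⟫_ℝ) F
    rw [Fintype.card_coe, hI] at h
    rw [h]
    refine Finset.sum_congr rfl fun J hJ => ?_
    exact (det_sum_weighted_eq_mul_minorSq (fun i l => ⟪e i, f l⟫_ℝ) w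
      (hI.trans (Finset.mem_powersetCard.1 hJ).2.symm)).symm
  simp only [hF]
  rw [principalMinor_eq]
  refine ((continuous_id.matrix_det).tendsto _).comp (tendsto_pi_nhds.2 fun i =>
    tendsto_pi_nhds.2 fun j => ?_)
  exact hasSum_matrix_of_diagonal e f hT i j

/-- Tonelli for a nonnegative double series. -/
theorem hasSum_of_hasSum_rows {α β : Type*} {q : α → β → ℝ} (hq : ∀ a b, 0 ≤ q a b) {s : α → ℝ}
    {r : β → ℝ} (hs : Summable s) (h1 : ∀ a, HasSum (q a) (s a))
    (h2 : ∀ b, HasSum (fun a => q a b) (r b)) : HasSum r (∑' a, s a) := by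
  have hp : Summable fun p : α × β => q p.1 p.2 := by
    rw [summable_prod_of_nonneg fun p => hq p.1 p.2]
    exact ⟨fun a => (h1 a).summable, by simpa only [(h1 _).tsum_eq] using hs⟩
  obtain ⟨t, h3⟩ := hp
  rw [(h3.prod_fiberwise h1).tsum_eq]
  have h4 : HasSum (fun p : β × α => q p.2 p.1) t := (Equiv.prodComm β α).hasSum_iff.2 h3
  exact h4.prod_fiberwise h2

/-- The trace of `⋀ᵏ T` for a diagonalizable `T` with nonnegative summable eigenvalues `w` is the
`k`-th elementary symmetric function of `w`, in whichever basis the diagonal is summed. -/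
theorem isWedgeTrace_of_nonneg {κ : Type u} (f : HilbertBasis κ ℝ H) {T : H →L[ℝ] H} {w : κ → ℝ}
    (hw : ∀ l, 0 ≤ w l) (hws : Summable w) (hT : ∀ l, T (f l) = w l • f l) (k : ℕ) :
    IsWedgeTrace k T (∑' J : {J : Finset κ // J.card = k}, ∏ l ∈ J.1, w l) := by
  classical
  intro ι e
  let q : {J : Finset κ // J.card = k} → {I : Finset ι // I.card = k} → ℝ := fun J I =>
    (∏ l ∈ J.1, w l) * minorSq (fun i l => ⟪e i, f l⟫_ℝ) I.1 J.1
  have hq : ∀ J I, 0 ≤ q J I := fun J I =>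
    mul_nonneg (Finset.prod_nonneg fun l _ => hw l) (minorSq_nonneg _ (I.2.trans J.2.symm))
  -- by Cauchy–Binet for the identity, the squared minors with columns `J` sum up to `1`
  have h1 : ∀ J, HasSum (q J) (∏ l ∈ J.1, w l) := fun J => by
    have h := hasSum_principalMinor f e (T := 1) (w := 1) (fun _ => zero_le_one)
      (fun l => by simp) J.2
    rw [principalMinor_one] at h
    have h2 := h.mul_left (∏ l ∈ J.1, w l)
    rw [mul_one] at h2
    refine h2.congr_fun fun I => ?_
    have h4 := minorSq_flip (fun i l => ⟪e i, f l⟫_ℝ) (I.2.trans J.2.symm)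
    have h5 : (fun l i => ⟪e i, f l⟫_ℝ) = fun l i => ⟪f l, e i⟫_ℝ :=
      funext fun l => funext fun i => real_inner_comm _ _
    rw [h5] at h4
    rw [Pi.one_def, Finset.prod_const_one, one_mul, h4]
  have hsum : Summable fun J : {J : Finset κ // J.card = k} => ∏ l ∈ J.1, w l :=
    (summable_finsetProd_of_summable_nonneg hw hws).subtype {J : Finset κ | J.card = k}
  refine hasSum_of_hasSum_rows hq hsum h1 fun I => ?_
  exact hasSum_principalMinor e f hw hT I.2

theorem wedgeTrace_eq {k : ℕ} {T : H →L[ℝ] H} {t : ℝ} (h : IsWedgeTrace k T t) :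
    wedgeTrace k T = t := by
  have hex : ∃ t, IsWedgeTrace k T t := ⟨t, h⟩
  obtain ⟨ι, ⟨e⟩⟩ := exists_hilbertBasis_type H
  rw [wedgeTrace, dif_pos hex]
  exact (hex.choose_spec ι e).unique (h ι e)

/-- The Fredholm determinant of a diagonalizable operator with eigenvalues `-w l ≤ 0`. -/
theorem fredholmDet_eq_tprod {κ : Type u} (f : HilbertBasis κ ℝ H) {T : H →L[ℝ] H} {w : κ → ℝ}
    (hw : ∀ l, 0 ≤ w l) (hws : Summable w) (hT : ∀ l, T (f l) = -w l • f l) :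
    fredholmDet T = ∏' l, (1 + -w l) := by
  have hs : Summable fun J : Finset κ => ∏ l ∈ J, -w l :=
    summable_finsetProd_of_summable_norm (by simpa using hws.norm)
  have hk : ∀ k, wedgeTrace k T = ∑' J : {J : Finset κ // J.card = k}, ∏ l ∈ J.1, -w l :=
    fun k => by
    refine wedgeTrace_eq fun ι e => ?_
    have h1 := isWedgeTrace_of_nonneg f (T := -T) hw hws (fun l => by simp [hT]) k ι e
    have h2 := h1.mul_left ((-1) ^ k)
    rw [← tsum_mul_left] at h2
    have h3 : ∀ J : {J : Finset κ // J.card = k},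
        (-1) ^ k * ∏ l ∈ J.1, w l = ∏ l ∈ J.1, -w l := fun J => by
      rw [Finset.prod_neg, J.2]
    simp only [h3] at h2
    refine h2.congr_fun fun I => ?_
    rw [principalMinor_neg, I.2, ← mul_assoc, ← mul_pow]
    simp
  rw [tprod_one_add hs, fredholmDet]
  simp only [hk]
  have hs' := (Equiv.sigmaFiberEquiv (Finset.card : Finset κ → ℕ)).summable_iff.2 hs
  exact hs'.tsum_sigma.symm.trans
    ((Equiv.sigmaFiberEquiv (Finset.card : Finset κ → ℕ)).tsum_eq fun J => ∏ l ∈ J, -w l)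

end Fredholm

/-! ### The regularized determinant of a positive operator -/

section Regularized

variable {H : Type u} [NormedAddCommGroup H] [InnerProductSpace ℝ H] [CompleteSpace H]

/-- A compact self-adjoint operator has an orthonormal basis of eigenvectors. -/
theorem exists_eigenbasis {T : H →L[ℝ] H} (hc : IsCompactOperator T)
    (hs : (T : H →ₗ[ℝ] H).IsSymmetric) :
    ∃ (κ : Type u) (f : HilbertBasis κ ℝ H) (w : κ → ℝ), ∀ l, T (f l) = w l • f l := by
  let E : ℝ → Submodule ℝ H := fun μ => Module.End.eigenspace (T : Module.End ℝ H) μ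
  have hE : ∀ μ x, x ∈ E μ ↔ T x = μ • x := fun μ x => Module.End.mem_eigenspace_iff
  have hcl : ∀ μ, CompleteSpace (E μ) := fun μ => by
    have h1 : IsClosed (E μ : Set H) := by
      have h2 : (E μ : Set H) = {x | T x = μ • x} := Set.ext fun x => hE μ x
      rw [h2]
      exact isClosed_eq T.continuous (continuous_const_smul μ)
    exact h1.completeSpace_coe
  choose w b hb using fun μ => exists_hilbertBasis ℝ (E μ)
  have hfam : OrthogonalFamily ℝ (fun μ => E μ) fun μ => (E μ).subtypeₗᵢ :=
    hs.orthogonalFamily_eigenspaces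
  have hv : Orthonormal ℝ fun p : Σ μ, w μ => (b p.1 p.2 : H) :=
    hfam.orthonormal_sigma_orthonormal (v_family := fun μ => b μ) fun μ => (b μ).orthonormal
  have hbot : (Submodule.span ℝ (Set.range fun p : Σ μ, w μ => (b p.1 p.2 : H)))ᗮ = ⊥ := by
    rw [eq_bot_iff, ← T.orthogonalComplement_iSup_eigenspaces_eq_bot hc hs,
      ← Submodule.iInf_orthogonal]
    intro x hx
    rw [Submodule.mem_iInf]
    intro μ
    rw [← Submodule.orthogonalProjectionOnto_eq_zero_iff]
    refine norm_eq_zero.1 (pow_eq_zero_iff two_ne_zero |>.1 ?_)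
    refine (hasSum_sq_inner (b μ) _).unique ?_
    have h0 : ∀ i, ⟪b μ i, (E μ).orthogonalProjectionOnto x⟫_ℝ = 0 := fun i => by
      rw [Submodule.inner_orthogonalProjectionOnto_eq_of_mem_left]
      exact hx _ (Submodule.subset_span ⟨⟨μ, i⟩, rfl⟩)
    exact hasSum_zero.congr_fun fun i => by rw [h0, zero_pow two_ne_zero]
  refine ⟨Σ μ, w μ, HilbertBasis.mkOfOrthogonalEqBot hv hbot, fun p => p.1, fun p => ?_⟩
  rw [HilbertBasis.coe_mkOfOrthogonalEqBot]
  exact (hE _ _).1 (b p.1 p.2).2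

theorem exp_apply_of_apply_eq_smul {T : H →L[ℝ] H} {x : H} {c : ℝ} (h : T x = c • x) :
    NormedSpace.exp T x = Real.exp c • x := by
  have hpow : ∀ n : ℕ, (T ^ n) x = c ^ n • x := fun n => by
    induction n with
    | zero => simp
    | succ n ih => rw [pow_succ', mul_apply_eq_comp, ih, map_smul, h, smul_smul, pow_succ]
  have h1 := (NormedSpace.exp_series_hasSum_exp' (𝕂 := ℝ) T).mapL
    (ContinuousLinearMap.apply ℝ H x)
  have h2 := (NormedSpace.exp_series_hasSum_exp' (𝕂 := ℝ) c).smul_const x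
  rw [Real.exp_eq_exp_ℝ]
  refine h1.unique (h2.congr_fun fun n => ?_)
  simp [hpow, smul_smul]

theorem regularize_apply_of_apply_eq_smul {A : H →L[ℝ] H} {x : H} {c : ℝ} (h : A x = c • x) :
    regularize A x = -(1 - (1 + c) * Real.exp (-c)) • x := by
  have h1 : (-A) x = (-c) • x := by simp [h]
  rw [regularize, sub_apply, mul_apply_eq_comp, exp_apply_of_apply_eq_smul h1, map_smul,
    add_apply, one_apply_eq_self, h]
  module

/-- For a self-adjoint Hilbert–Schmidt operator with eigenvalues `c > -1`, the operator
`R₂(A)` has the eigenvalues `-w` with `w = 1 - (1 + c) e^{-c} ∈ [0, c²]` and `w < 1`, so that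
`det₂ (1 + A)` is the nonzero convergent product `∏ (1 - w)`. -/
theorem det₂_ne_zero {A : H →L[ℝ] H} (hA : IsHilbertSchmidt A)
    (hs : (A : H →ₗ[ℝ] H).IsSymmetric) {δ : ℝ} (hδ : 0 < δ)
    (hpos : ∀ x, δ * ‖x‖ ^ 2 ≤ ⟪(1 + A) x, x⟫_ℝ) : det₂ A ≠ 0 := by
  obtain ⟨κ, f, c, hf⟩ := exists_eigenbasis hA.isCompactOperator hs
  have hc : ∀ l, 0 < 1 + c l := fun l => by
    have h := hpos (f l)
    rw [f.orthonormal.1 l, add_apply, one_apply_eq_self, hf, inner_add_left, inner_smul_left,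
      real_inner_self_eq_norm_sq, f.orthonormal.1 l] at h
    simp at h
    linarith
  let w : κ → ℝ := fun l => 1 - (1 + c l) * Real.exp (-c l)
  have hw0 : ∀ l, 0 ≤ w l := fun l => by
    have h1 : 1 + c l ≤ Real.exp (c l) := by linarith [Real.add_one_le_exp (c l)]
    have h2 : (1 + c l) * Real.exp (-c l) ≤ Real.exp (c l) * Real.exp (-c l) := by gcongr
    rw [← Real.exp_add, add_neg_cancel, Real.exp_zero] at h2
    simp only [w]
    linarith
  have hw1 : ∀ l, w l ≤ c l ^ 2 := fun l => by
    have h1 : 1 - c l ≤ Real.exp (-c l) := by linarith [Real.add_one_le_exp (-c l)]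
    have h2 : (1 + c l) * (1 - c l) ≤ (1 + c l) * Real.exp (-c l) :=
      mul_le_mul_of_nonneg_left h1 (hc l).le
    simp only [w]
    nlinarith
  have hcs : Summable fun l => c l ^ 2 := by
    have h := hA.summable f
    simpa [hf, norm_smul, f.orthonormal.1] using h
  have hws : Summable w := hcs.of_nonneg_of_le hw0 hw1
  rw [det₂, fredholmDet_eq_tprod f hw0 hws fun l => regularize_apply_of_apply_eq_smul (hf l)]
  refine tprod_one_add_ne_zero_of_summable (fun l => ?_) (by simpa using hws.norm)
  have h : 0 < (1 + c l) * Real.exp (-c l) := mul_pos (hc l) (Real.exp_pos _)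
  simp only [w]
  linarith

end Regularized

/-! ### Factorization of positive operators -/

section Factorization

variable {H : Type u} [NormedAddCommGroup H] [InnerProductSpace ℝ H] [CompleteSpace H]

theorem adjoint_mul (A B : H →L[ℝ] H) : (A * B).adjoint = B.adjoint * A.adjoint :=
  ContinuousLinearMap.adjoint_comp A B

theorem adjoint_one : (1 : H →L[ℝ] H).adjoint = 1 := by
  rw [← ContinuousLinearMap.star_eq_adjoint, star_one]

theorem isUnit_adjoint {T : H →L[ℝ] H} (hT : IsUnit T) : IsUnit T.adjoint := by
  rw [← ContinuousLinearMap.star_eq_adjoint]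
  exact hT.star

theorem exists_coercive_mul_adjoint {T : H →L[ℝ] H} (hT : IsUnit T) :
    ∃ δ > 0, ∀ x, δ * ‖x‖ ^ 2 ≤ ⟪(T * T.adjoint) x, x⟫_ℝ := by
  have hinv := Ring.inverse_mul_cancel _ (isUnit_adjoint hT)
  set R := Ring.inverse T.adjoint
  have hC : 0 < ‖R‖ + 1 := by positivity
  refine ⟨((‖R‖ + 1) ^ 2)⁻¹, by positivity, fun x => ?_⟩
  have hx : R (T.adjoint x) = x := congrArg (fun L : H →L[ℝ] H => L x) hinv
  have h1 : ‖x‖ ≤ (‖R‖ + 1) * ‖T.adjoint x‖ := by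
    calc ‖x‖ = ‖R (T.adjoint x)‖ := by rw [hx]
      _ ≤ ‖R‖ * ‖T.adjoint x‖ := R.le_opNorm _
      _ ≤ _ := by
        gcongr
        linarith
  rw [mul_apply_eq_comp, ← ContinuousLinearMap.adjoint_inner_right, real_inner_self_eq_norm_sq,
    inv_mul_le_iff₀ (by positivity), ← mul_pow]
  gcongr

theorem one_add_mul_adjoint (K : H →L[ℝ] H) :
    1 + (K + K.adjoint + K * K.adjoint) = (1 + K) * (1 + K).adjoint := by
  rw [map_add, adjoint_one]
  noncomm_ring

theorem eq_inverse_of_mul_eq_one {b L : H →L[ℝ] H} (hb : IsUnit b) (h : L * b = 1) :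
    L = Ring.inverse b := by
  rw [← mul_one L, ← Ring.mul_inverse_cancel b hb, ← mul_assoc, h, one_mul]

theorem isTriangular_of_mem_lowerGroup {b : L2R →L[ℝ] L2R} (hb : b ∈ lowerGroup) :
    IsTriangular tail b := by
  have h := IsTriangular.one.add (isTriangular_of_mem_lowerAlgebra hb)
  rwa [add_sub_cancel] at h

theorem isTriangular_inverse_of_mem_lowerGroup {b : L2R →L[ℝ] L2R} (hb : b ∈ lowerGroup)
    (hu : IsUnit b) : IsTriangular tail (Ring.inverse b) := by
  have h := isTriangular_of_mem_lowerGroup hb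
  have hc := (isHilbertSchmidt_of_mem_lowerAlgebra hb).isCompactOperator
  rw [← add_sub_cancel 1 b] at hu h ⊢
  exact IsTriangular.inverse hc hu h

/-- Existence of the triangular factor of a positive operator `1 + S`. If `C` solves the triangular
equation and `b = (1 + S)(1 + C)`, then `(1 + C)* b` is triangular and self-adjoint, hence equal to
`1`. -/
theorem exists_lower_mul_adjoint {S : L2R →L[ℝ] L2R} (hS : IsHilbertSchmidt S)
    (hsa : S.adjoint = S) {δ : ℝ} (hδ : 0 < δ)
    (hpos : ∀ x, δ * ‖x‖ ^ 2 ≤ ⟪(1 + S) x, x⟫_ℝ) :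
    ∃ b ∈ lowerGroup, IsUnit b ∧ b * b.adjoint = 1 + S := by
  obtain ⟨C, hC, hCt, hB⟩ := exists_triangular_solution (N := tail) tail_total hS hδ hpos
  set B := S + C + S * C with hBdef
  have hBs : IsHilbertSchmidt B := (hS.add hC).add (hS.mul_right C)
  have hb : 1 + B = (1 + S) * (1 + C) := by
    rw [hBdef]
    noncomm_ring
  have hL : (1 + C).adjoint = 1 + C.adjoint := by rw [map_add, adjoint_one]
  let D := (1 + C.adjoint) * (1 + B) - 1
  have hD : D = B + C.adjoint + C.adjoint * B := by
    simp only [D]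
    noncomm_ring
  have hDs : IsHilbertSchmidt D := by
    rw [hD]
    exact (hBs.add hC.adjoint).add (hBs.mul_left _)
  have hDt : IsTriangular tail D := by
    rw [hD]
    exact (hB.add hCt).add (hCt.mul hB)
  have hDa : D.adjoint = D := by
    simp only [D]
    have hSa : (1 + S).adjoint = 1 + S := by rw [map_add, adjoint_one, hsa]
    rw [hb, ← hL, map_sub, adjoint_one, adjoint_mul, adjoint_mul,
      ContinuousLinearMap.adjoint_adjoint, hSa, mul_assoc]
  have hD0 : D = 0 := eq_zero_of_isTriangular_adjoint hDs hDt (by rwa [hDa])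
  have h1 : (1 + C.adjoint) * (1 + B) = 1 := sub_eq_zero.1 hD0
  have hu : IsUnit (1 + B) := by
    refine isUnit_one_add_of_isCompactOperator hBs.isCompactOperator fun x hx => ?_
    have h2 := congrArg (fun T : L2R →L[ℝ] L2R => T x) h1
    simp only [mul_apply_eq_comp, hx, map_zero, one_apply_eq_self] at h2
    exact h2.symm
  refine ⟨1 + B, ?_, hu, ?_⟩
  · rw [lowerGroup, Set.mem_ofPred_eq, add_sub_cancel_left]
    exact mem_lowerAlgebra_of_isTriangular hBs hB
  · have h2 : (1 + B) * (1 + C.adjoint) = 1 := by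
      rw [eq_inverse_of_mul_eq_one hu h1, Ring.mul_inverse_cancel _ hu]
    have h3 := congrArg ContinuousLinearMap.adjoint h2
    rw [adjoint_mul, ← hL, ContinuousLinearMap.adjoint_adjoint, adjoint_one] at h3
    nth_rewrite 1 [hb]
    rw [mul_assoc, h3, mul_one]

/-- Two triangular factors of the same operator coincide: `b⁻¹ b'` is orthogonal, so that both it
and its adjoint are triangular. -/
theorem lower_factor_unique {b b' : L2R →L[ℝ] L2R} (hb : b ∈ lowerGroup) (hu : IsUnit b)
    (hb' : b' ∈ lowerGroup) (hu' : IsUnit b') (h : b * b.adjoint = b' * b'.adjoint) :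
    b = b' := by
  have hi := Ring.inverse_mul_cancel _ hu
  have hi' := Ring.inverse_mul_cancel _ hu'
  have hj := Ring.mul_inverse_cancel _ hu
  have hj' := Ring.mul_inverse_cancel _ hu'
  have hia : b.adjoint * (Ring.inverse b).adjoint = 1 := by
    rw [← adjoint_mul, hi, adjoint_one]
  let V := Ring.inverse b * b'
  let W := Ring.inverse b' * b
  have hWV : W * V = 1 := by
    simp only [V, W]
    rw [mul_assoc, ← mul_assoc b, hj, one_mul, hi']
  have hVV : V * V.adjoint = 1 := by
    simp only [V]
    rw [adjoint_mul, mul_assoc, ← mul_assoc b', ← h, mul_assoc, hia, mul_one, hi]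
  have hVa : V.adjoint = W := by
    rw [← one_mul V.adjoint, ← hWV, mul_assoc, hVV, mul_one]
  have hVt : IsTriangular tail V :=
    (isTriangular_inverse_of_mem_lowerGroup hb hu).mul (isTriangular_of_mem_lowerGroup hb')
  have hWt : IsTriangular tail W :=
    (isTriangular_inverse_of_mem_lowerGroup hb' hu').mul (isTriangular_of_mem_lowerGroup hb)
  have hVs : IsHilbertSchmidt (V - 1) := by
    have h1 : V - 1 = Ring.inverse b * ((b' - 1) - (b - 1)) := by
      simp only [V]
      rw [sub_sub_sub_cancel_right, mul_sub, hi]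
    rw [h1]
    exact ((isHilbertSchmidt_of_mem_lowerAlgebra hb').sub
      (isHilbertSchmidt_of_mem_lowerAlgebra hb)).mul_left _
  have h0 : V - 1 = 0 := by
    refine eq_zero_of_isTriangular_adjoint hVs (hVt.sub IsTriangular.one) ?_
    rw [map_sub, hVa, adjoint_one]
    exact hWt.sub IsTriangular.one
  have hV1 : Ring.inverse b * b' = 1 := sub_eq_zero.1 h0
  rw [← mul_one b, ← hV1, ← mul_assoc, hj, one_mul]

theorem factor_mul_adjoint {K b₁ b₂ : L2R →L[ℝ] L2R} (hK : IsUnit (1 + K))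
    (h₂ : b₂ ∈ orthogonalHS) (h : 1 + K = b₁ * Ring.inverse b₂) :
    b₁ = (1 + K) * b₂ ∧ IsUnit b₁ ∧
      b₁ * b₁.adjoint = 1 + (K + K.adjoint + K * K.adjoint) := by
  have hu : IsUnit b₂ := h₂.1.1
  have h1 : b₁ = (1 + K) * b₂ := by
    rw [h, mul_assoc, Ring.inverse_mul_cancel _ hu, mul_one]
  refine ⟨h1, h1 ▸ hK.mul hu, ?_⟩
  rw [one_add_mul_adjoint, h1, adjoint_mul, mul_assoc, ← mul_assoc b₂, h₂.2.1, one_mul]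

theorem existsUnique_factorization {K : L2R →L[ℝ] L2R} (hK : 1 + K ∈ hsGroup) :
    ∃! b : (L2R →L[ℝ] L2R) × (L2R →L[ℝ] L2R),
      b.1 ∈ lowerGroup ∧ b.2 ∈ orthogonalHS ∧ 1 + K = b.1 * Ring.inverse b.2 := by
  obtain ⟨hKu, hKs⟩ := hK
  rw [add_sub_cancel_left] at hKs
  have hi := Ring.inverse_mul_cancel _ hKu
  have hj := Ring.mul_inverse_cancel _ hKu
  obtain ⟨δ, hδ, hpos⟩ := exists_coercive_mul_adjoint hKu
  rw [← one_add_mul_adjoint] at hpos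
  have hsa : (K + K.adjoint + K * K.adjoint).adjoint = K + K.adjoint + K * K.adjoint := by
    rw [map_add, map_add, adjoint_mul, ContinuousLinearMap.adjoint_adjoint, add_comm K.adjoint K]
  obtain ⟨b, hb, hbu, hbb⟩ := exists_lower_mul_adjoint
    ((hKs.add hKs.adjoint).add (hKs.mul_right K.adjoint)) hsa hδ hpos
  have hbs := isHilbertSchmidt_of_mem_lowerAlgebra hb
  let k := Ring.inverse (1 + K) * b
  have hku : IsUnit k := (isUnit_ringInverse.2 hKu).mul hbu
  have hkk : k * k.adjoint = 1 := by
    have h1 : (1 + K).adjoint * (Ring.inverse (1 + K)).adjoint = 1 := by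
      rw [← adjoint_mul, hi, adjoint_one]
    simp only [k]
    rw [adjoint_mul, mul_assoc, ← mul_assoc b, hbb, one_add_mul_adjoint, mul_assoc, h1, mul_one, hi]
  have hkk' : k.adjoint * k = 1 := by
    have h1 := eq_inverse_of_mul_eq_one (isUnit_adjoint hku) hkk
    exact (congrArg (fun T => k.adjoint * T) h1).trans
      (Ring.mul_inverse_cancel _ (isUnit_adjoint hku))
  have hks : IsHilbertSchmidt (k - 1) := by
    have h1 : k - 1 = Ring.inverse (1 + K) * ((b - 1) - K) := by
      have h2 : (b - 1) - K = b - (1 + K) := by abel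
      rw [h2, mul_sub, hi]
    rw [h1]
    exact (hbs.sub hKs).mul_left _
  have hbk : 1 + K = b * Ring.inverse k := by
    have h1 : b = (1 + K) * k := by
      simp only [k]
      rw [← mul_assoc, hj, one_mul]
    calc 1 + K = (1 + K) * (k * Ring.inverse k) := by
          rw [Ring.mul_inverse_cancel _ hku, mul_one]
      _ = (1 + K) * k * Ring.inverse k := (mul_assoc _ _ _).symm
      _ = b * Ring.inverse k := by rw [← h1]
  refine ⟨(b, k), ⟨hb, ⟨⟨hku, hks⟩, hkk, hkk'⟩, hbk⟩, ?_⟩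
  rintro ⟨b', k'⟩ ⟨hb', hk', h'⟩
  obtain ⟨h1, hu', hbb'⟩ := factor_mul_adjoint hKu hk' h'
  have hbeq : b' = b := lower_factor_unique hb' hu' hb hbu (hbb'.trans hbb.symm)
  have hkeq : k' = k := by
    simp only [k]
    rw [← hbeq]
    change b' = _ at h1
    rw [h1, ← mul_assoc, hi, one_mul]
  rw [hbeq, hkeq]

end Factorization

/-! ### Columns of kernels and the truncated equation -/

section Columns

theorem trunc_add (T T' : L2R →L[ℝ] L2R) (y : ℝ) : trunc (T + T') y = trunc T y + trunc T' y := by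
  ext1 φ
  simp [trunc]

theorem trunc_one_add (S : L2R →L[ℝ] L2R) (y : ℝ) : trunc (1 + S) y = 1 + trunc S y := by
  rw [trunc_add, trunc_one]

theorem inner_trunc (T : L2R →L[ℝ] L2R) (y : ℝ) (φ ψ : L2Iio y) :
    ⟪trunc T y φ, ψ⟫_ℝ = ⟪T ((restrictL2 y).adjoint φ), (restrictL2 y).adjoint ψ⟫_ℝ := by
  rw [ContinuousLinearMap.adjoint_inner_right]
  rfl

theorem norm_adjoint_restrictL2 (y : ℝ) (φ : L2Iio y) : ‖(restrictL2 y).adjoint φ‖ = ‖φ‖ := by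
  rw [← sq_eq_sq₀ (norm_nonneg _) (norm_nonneg _), ← real_inner_self_eq_norm_sq,
    ContinuousLinearMap.adjoint_inner_left, restrictL2_adjoint_apply, real_inner_self_eq_norm_sq]

theorem trunc_coercive {T : L2R →L[ℝ] L2R} {δ : ℝ} (h : ∀ x, δ * ‖x‖ ^ 2 ≤ ⟪T x, x⟫_ℝ) (y : ℝ)
    (φ : L2Iio y) : δ * ‖φ‖ ^ 2 ≤ ⟪trunc T y φ, φ⟫_ℝ := by
  rw [inner_trunc, ← norm_adjoint_restrictL2]
  exact h _

theorem trunc_isSymmetric {T : L2R →L[ℝ] L2R} (hT : T.adjoint = T) (y : ℝ) :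
    (trunc T y : L2Iio y →ₗ[ℝ] L2Iio y).IsSymmetric := fun φ ψ => by
  change ⟪trunc T y φ, ψ⟫_ℝ = ⟪φ, trunc T y ψ⟫_ℝ
  rw [inner_trunc, real_inner_comm (trunc T y ψ) φ, inner_trunc]
  conv_rhs => rw [← hT, ContinuousLinearMap.adjoint_inner_left, real_inner_comm]

theorem restrictL2_toLp {f : ℝ → ℝ} (hf : MemLp f 2 volume) (y : ℝ) :
    restrictL2 y (hf.toLp f) = (hf.restrict (Set.Iio y)).toLp f := by
  refine Lp.ext ?_
  filter_upwards [LpToLpRestrictCLM_coeFn (𝕜 := ℝ) (Set.Iio y) (hf.toLp f),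
    ae_restrict_of_ae hf.coeFn_toLp, (hf.restrict (Set.Iio y)).coeFn_toLp] with x h1 h2 h3
  rw [h3, ← h2]
  exact h1

/-- The columns of the kernel of `A + C + A C` are the columns of `A`, plus those of `C`, plus the
images under `A` of those of `C`. Both sides are tested against a countable dense set, where the
pairing of the column at `y` with `ψ` is the value at `y` of the adjoint applied to `ψ`. -/
theorem HasKernel.ae_column_eq {A B C : L2R →L[ℝ] L2R} {a b c : ℝ → ℝ → ℝ}
    (hA : HasKernel volume A a) (hB : HasKernel volume B b) (hC : HasKernel volume C c)
    (h : B = A + C + A * C) :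
    ∀ᵐ y : ℝ, ∃ (ha : MemLp (fun x => a x y) 2 volume) (hb : MemLp (fun x => b x y) 2 volume)
      (hc : MemLp (fun x => c x y) 2 volume),
      hb.toLp _ = ha.toLp _ + hc.toLp _ + A (hc.toLp _) := by
  have : Fact ((1 : ENNReal) ≤ 2) := ⟨one_le_two⟩
  have : Fact ((2 : ENNReal) ≠ ⊤) := ⟨ENNReal.ofNat_ne_top⟩
  let D : ℕ → L2R := TopologicalSpace.denseSeq L2R
  have hadj : ∀ ψ, B.adjoint ψ = A.adjoint ψ + C.adjoint ψ + C.adjoint (A.adjoint ψ) := fun ψ => by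
    rw [h, map_add, map_add, adjoint_mul]
    rfl
  have hD : ∀ᵐ y : ℝ, ∀ n, ∫ x, b x y * D n x =
      (∫ x, a x y * D n x) + (∫ x, c x y * D n x) + ∫ x, c x y * A.adjoint (D n) x := by
    rw [ae_all_iff]
    intro n
    filter_upwards [hA.adjoint.2 (D n), hB.adjoint.2 (D n), hC.adjoint.2 (D n),
      hC.adjoint.2 (A.adjoint (D n)),
      Lp.coeFn_add (A.adjoint (D n) + C.adjoint (D n)) (C.adjoint (A.adjoint (D n))),
      Lp.coeFn_add (A.adjoint (D n)) (C.adjoint (D n))] with y h1 h2 h3 h4 h5 h6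
    rw [← h1, ← h2, ← h3, ← h4, hadj, h5, Pi.add_apply, h6, Pi.add_apply]
  filter_upwards [hD, memLp_row (memLp_transpose hA.1), memLp_row (memLp_transpose hB.1),
    memLp_row (memLp_transpose hC.1)] with y hy ha hb hc
  refine ⟨ha, hb, hc, ext_inner_right ℝ fun ψ => ?_⟩
  refine (TopologicalSpace.denseRange_denseSeq L2R).induction_on
    (p := fun ψ => ⟪hb.toLp _, ψ⟫_ℝ = ⟪ha.toLp _ + hc.toLp _ + A (hc.toLp _), ψ⟫_ℝ) ψ ?_ fun n => ?_
  · exact isClosed_eq (continuous_const.inner continuous_id) (continuous_const.inner continuous_id)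
  · rw [inner_add_left, inner_add_left, ← ContinuousLinearMap.adjoint_inner_right,
      inner_toLp_left, inner_toLp_left, inner_toLp_left, inner_toLp_left]
    exact hy n

end Columns

/-- The column equation, truncated to `(-∞, y)`. -/
theorem HasKernel.ae_trunc_column_eq {S B C : L2R →L[ℝ] L2R} {s c : ℝ → ℝ → ℝ}
    (hS : HasKernel volume S s) (hC : HasKernel volume C c) (hB : B ∈ lowerAlgebra)
    (h : B = S + C + S * C)
    (hc : ∀ᵐ y : ℝ, ∀ᵐ x ∂(volume.restrict (Set.Ioi y)), c x y = 0) :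
    ∀ᵐ y : ℝ, ∃ (hs : MemLp (fun x => s x y) 2 (volume.restrict (Set.Iio y)))
      (hc : MemLp (fun x => c x y) 2 (volume.restrict (Set.Iio y))),
      trunc (1 + S) y (hc.toLp _) = -hs.toLp _ := by
  obtain ⟨b, hb, hb0⟩ := exists_hasKernel_of_mem_lowerAlgebra hB
  filter_upwards [hS.ae_column_eq hb hC h, hc] with y ⟨hsy, hby, hcy, heq⟩ hy0
  refine ⟨hsy.restrict _, hcy.restrict _, ?_⟩
  -- the column of `B` vanishes on `(-∞, y)`, the column of `C` on `(y, ∞)`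
  have h1 : restrictL2 y (hby.toLp _) = 0 := by
    rw [← mem_tail, mem_tail_iff]
    filter_upwards [hby.coeFn_toLp] with x hx hxy
    rw [hx, hb0 x y hxy.le]
  have h2 : (restrictL2 y).adjoint ((hcy.restrict (Set.Iio y)).toLp _) = hcy.toLp _ := by
    rw [← restrictL2_toLp hcy]
    refine Lp.ext ?_
    rw [ae_restrict_iff' measurableSet_Ioi] at hy0
    filter_upwards [adjoint_restrictL2_apply y (hcy.toLp _), hcy.coeFn_toLp, hy0,
      compl_mem_ae_iff.2 (measure_singleton y)] with x hx hx' hx0 hxy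
    rw [hx]
    rcases lt_or_gt_of_ne (show x ≠ y from hxy) with hlt | hgt
    · exact Set.indicator_of_mem (Set.mem_Iio.2 hlt) _
    · rw [Set.indicator_of_notMem (by simpa using hgt.le), hx', hx0 hgt]
  have h3 := congrArg (restrictL2 y) heq
  rw [h1, map_add, map_add, restrictL2_toLp, restrictL2_toLp] at h3
  have h4 : trunc S y ((hcy.restrict (Set.Iio y)).toLp _) = restrictL2 y (S (hcy.toLp _)) := by
    rw [← h2]
    rfl
  rw [trunc_one_add, add_apply, one_apply_eq_self, h4, eq_neg_iff_add_eq_zero, h3]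
  abel

end HSFactor

end

open HSFactor in
theorem theorem3p1
    (K : HSFactor.L2R →L[ℝ] HSFactor.L2R) (hK : 1 + K ∈ HSFactor.hsGroup) :
    -- existence and uniqueness of the factorization
    (∃! b : (HSFactor.L2R →L[ℝ] HSFactor.L2R) × (HSFactor.L2R →L[ℝ] HSFactor.L2R),
      b.1 ∈ HSFactor.lowerGroup ∧ b.2 ∈ HSFactor.orthogonalHS ∧
        1 + K = b.1 * Ring.inverse b.2) ∧
    -- the explicit formula
    ∀ b₁ b₂ : HSFactor.L2R →L[ℝ] HSFactor.L2R,
      b₁ ∈ HSFactor.lowerGroup → b₂ ∈ HSFactor.orthogonalHS → 1 + K = b₁ * Ring.inverse b₂ →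
      ∀ S : HSFactor.L2R →L[ℝ] HSFactor.L2R, S = K + K.adjoint + K * K.adjoint →
        b₁ ∈ HSFactor.hsGroup ∧
        (∃ s, HSFactor.HasKernel volume S s) ∧
        (∃ c, HSFactor.HasKernel volume ((Ring.inverse b₁).adjoint - 1) c) ∧
        (∀ y : ℝ, IsUnit (HSFactor.trunc (1 + S) y) ∧ HSFactor.det₂ (HSFactor.trunc S y) ≠ 0) ∧
        ∀ s c : ℝ → ℝ → ℝ, HSFactor.HasKernel volume S s →
          HSFactor.HasKernel volume ((Ring.inverse b₁).adjoint - 1) c →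
          ∀ᵐ y : ℝ,
            (∃ hs : MemLp (fun x => s x y) 2 (volume.restrict (Set.Iio y)),
              ∀ᵐ x ∂(volume.restrict (Set.Iio y)),
                c x y = -(Ring.inverse (HSFactor.trunc (1 + S) y) (hs.toLp _)) x ∧
                c x y = -s x y - (HSFactor.minor₂ (HSFactor.trunc S y) (hs.toLp _)) x /
                  HSFactor.det₂ (HSFactor.trunc S y)) ∧
            ∀ᵐ x ∂(volume.restrict (Set.Ioi y)), c x y = 0 := by
  refine ⟨existsUnique_factorization hK, ?_⟩
  rintro b₁ b₂ h₁ h₂ h S hS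
  have hKs : IsHilbertSchmidt K := by simpa using hK.2
  obtain ⟨-, hu, hbb⟩ := factor_mul_adjoint hK.1 h₂ h
  rw [← hS] at hbb
  have hSs : IsHilbertSchmidt S := by
    rw [hS]
    exact (hKs.add hKs.adjoint).add (hKs.mul_right _)
  have hSa : S.adjoint = S := by
    rw [hS, map_add, map_add, adjoint_mul, ContinuousLinearMap.adjoint_adjoint,
      add_comm K.adjoint K]
  obtain ⟨δ, hδ, hpos⟩ := exists_coercive_mul_adjoint hK.1
  rw [← one_add_mul_adjoint, ← hS] at hpos
  have hbs := isHilbertSchmidt_of_mem_lowerAlgebra h₁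
  have hi := Ring.inverse_mul_cancel _ hu
  have hj := Ring.mul_inverse_cancel _ hu
  set C := (Ring.inverse b₁).adjoint - 1 with hCdef
  have hCa : C.adjoint = Ring.inverse b₁ - 1 := by
    rw [hCdef, map_sub, ContinuousLinearMap.adjoint_adjoint, adjoint_one]
  have hCt : IsTriangular tail C.adjoint := by
    rw [hCa]
    exact (isTriangular_inverse_of_mem_lowerGroup h₁ hu).sub IsTriangular.one
  have hCs : IsHilbertSchmidt C := by
    have h3 : C.adjoint = -(Ring.inverse b₁ * (b₁ - 1)) := by
      rw [hCa, mul_sub, hi, mul_one, neg_sub]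
    rw [← ContinuousLinearMap.adjoint_adjoint C, h3]
    exact (hbs.mul_left _).neg.adjoint
  have hB : b₁ - 1 = S + C + S * C := by
    have h3 : b₁.adjoint * (Ring.inverse b₁).adjoint = 1 := by
      rw [← adjoint_mul, hi, adjoint_one]
    have h4 : (1 + S) * (1 + C) = b₁ := by
      rw [← hbb, hCdef, add_sub_cancel, mul_assoc, h3, mul_one]
    rw [← h4]
    noncomm_ring
  have hunit : ∀ y, IsUnit (trunc (1 + S) y) := fun y =>
    isUnit_of_coercive hδ (trunc_coercive hpos y)
  have hdet : ∀ y, det₂ (trunc S y) ≠ 0 := fun y => by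
    obtain ⟨s, -, hs⟩ := hSs.exists_hasKernel
    refine det₂_ne_zero (hasKernel_trunc hs y).isHilbertSchmidt (trunc_isSymmetric hSa y) hδ ?_
    rw [← trunc_one_add]
    exact trunc_coercive hpos y
  refine ⟨⟨hu, hbs⟩, ?_, ?_, fun y => ⟨hunit y, hdet y⟩, fun s c hs hc => ?_⟩
  · obtain ⟨s, -, hs⟩ := hSs.exists_hasKernel
    exact ⟨s, hs⟩
  · obtain ⟨c, -, hc⟩ := hCs.exists_hasKernel
    exact ⟨c, hc⟩
  have hc0 := hc.adjoint.ae_eq_zero hCt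
  filter_upwards [hs.ae_trunc_column_eq hc h₁ hB hc0, hc0] with y ⟨hsy, hcy, heq⟩ hy0
  refine ⟨⟨hsy, ?_⟩, hy0⟩
  set v := hsy.toLp _
  have hT := trunc_one_add S y
  have h3 : hcy.toLp _ = -Ring.inverse (trunc (1 + S) y) v := by
    have h4 : Ring.inverse (trunc (1 + S) y) (trunc (1 + S) y (hcy.toLp _)) =
        Ring.inverse (trunc (1 + S) y) (-v) := by rw [heq]
    rw [map_neg] at h4
    rw [← h4]
    exact (congrArg (fun T : L2Iio y →L[ℝ] L2Iio y => T (hcy.toLp _))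
      (Ring.inverse_mul_cancel _ (hunit y))).symm
  have h5 : hcy.toLp _ = -v - (det₂ (trunc S y))⁻¹ • minor₂ (trunc S y) v := by
    have h6 : (1 + trunc S y) (Ring.inverse (1 + trunc S y) v) = v := by
      rw [← hT]
      exact congrArg (fun T : L2Iio y →L[ℝ] L2Iio y => T v) (Ring.mul_inverse_cancel _ (hunit y))
    rw [add_apply, one_apply_eq_self] at h6
    have h7 : minor₂ (trunc S y) v =
        -(det₂ (trunc S y) • trunc S y (Ring.inverse (1 + trunc S y) v)) := rfl
    rw [h3, h7, smul_neg, smul_smul, inv_mul_cancel₀ (hdet y), one_smul, hT]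
    nth_rewrite 2 [← h6]
    abel
  have h8 := hcy.coeFn_toLp
  have h9 : ((hcy.toLp _ : L2Iio y) : ℝ → ℝ) =ᵐ[volume.restrict (Set.Iio y)]
      fun x => -(Ring.inverse (trunc (1 + S) y) v) x := by
    rw [h3]
    exact Lp.coeFn_neg _
  have h10 : ((hcy.toLp _ : L2Iio y) : ℝ → ℝ) =ᵐ[volume.restrict (Set.Iio y)]
      fun x => -v x - (det₂ (trunc S y))⁻¹ * (minor₂ (trunc S y) v) x := by
    rw [h5]
    filter_upwards [Lp.coeFn_sub (-v) ((det₂ (trunc S y))⁻¹ • minor₂ (trunc S y) v),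
      Lp.coeFn_neg v, Lp.coeFn_smul (det₂ (trunc S y))⁻¹ (minor₂ (trunc S y) v)] with x g1 g2 g3
    rw [g1, Pi.sub_apply, g2, g3, Pi.neg_apply, Pi.smul_apply, smul_eq_mul]
  filter_upwards [h8, h9, h10, hsy.coeFn_toLp] with x g1 g2 g3 g4
  refine ⟨by rw [← g1, g2], ?_⟩
  rw [← g1, g3, g4, div_eq_inv_mul]
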